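/- **Setting.** Let $d,n\ge 1$, $X^i\in\mathbb R^{m_i\times d}$ for $i=1,\dots,n$, $m=\sum_i m_i$, $y\in\mathbb R^m$, $\gamma>0$, $\sigma>0$, let $I\subseteq\{1,\dots,d\}\times\{1,\dots,n\}$ with $t=|I|$, and let $\tilde w,\tilde u\in\mathbb R^t$, where the coordinates of $\mathbb R^t$ are indexed by $I$. Let $X=\mathrm{Diag}(X^1,\dots,X^n)$, whose column $(i,j)$ multiplies the entry $W_{ij}$ of a matrix $W\in\mathbb R^{d\times n}$, and let $X_I\in\mathbb R^{m\times t}$ consist of its columns indexed by $I$. For $q\in\mathbb R^t$ let $Q\in\mathbb R^{d\times n}$ be its extension by zero. For each $i$ let $\lambda_i$ be the smallest index $k$ with $|Q_{ik}|=\max_j|Q_{ij}|$, and put $T_{i\lambda_i}=\operatorname{sign}(Q_{i\lambda_i})$ and $T_{ij}=0$ for $j\neq\lambda_i$. Let $\bar{\mathcal C}(q)$ be the polyhedron of all $z\in\mathbb R^t$ whose extension by zero $Z$ satisfies, for all $(i,j)$, $$-\operatorname{sign}(Q_{ij})Z_{ij}\le 0,\qquad \operatorname{sign}(Q_{ij})Z_{ij}-T_{i\lambda_i}Z_{i\lambda_i}\le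 0,\qquad \sum_{i=1}^d T_{i\lambda_i}Z_{i\lambda_i}\le\gamma ,$$ written $\bar{\mathcal C}(q)=\{z: \bar Bz\le c\}$ with $\bar B=\bar B(q)\in\mathbb R^{(2nd+1)\times t}$. Let $$\varphi(w)=\tfrac12\|y-X_Iw\|^2-\tfrac1{2\sigma}\|\tilde u\|^2+\sigma\min_{z\in\bar{\mathcal C}(q)}\tfrac12\|z-q\|^2\Big|_{q=w+\tilde u/\sigma}+\tfrac1{2\sigma}\|w-\tilde w\|^2,\qquad w\in\mathbb R^t .$$ (The minimum does not change if $\bar{\mathcal C}(q)$ is replaced by $\{z:\sum_i\max_j|Z_{ij}|\le\gamma\}$.) The generalized HS-Jacobian $\bar{\mathcal N}(q)$ is the set of the matrices $I_t-\bar B_K^\top(\bar B_K\bar B_K^\top)^{-1}\bar B_K$, where $\bar B=\bar B(q)$ and $K$ is a set of row indices such that $\bar B_K$ has full row rank and $\operatorname{supp}(\mu)\subseteq K\subseteq\{r:(\bar Bp)_r=c_r\}$, with $p$ the projection of $q$ onto $\bar{\mathcal C}(q)$ and $\mu$ some multiplier, i.e. $\mu\ge0$, $p-q+\bar B^\top\mu=0$,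 $\mu^\top(\bar Bp-c)=0$. Let $$\mathcal M(w)=\{X_I^\top X_I+\sigma(I_t-\bar N)+\sigma^{-1}I_t:\ \bar N\in\bar{\mathcal N}(w+\tilde u/\sigma)\}.$$ **Algorithm (semismooth Newton).** Let $\varrho\in(0,1/2)$, $\nu\in(0,1)$, $\tau\in(0,1]$, $\varpi\in(0,1)$ and $\bar w^0\in\mathbb R^t$. For $j=0,1,\dots$: choose $M_j\in\mathcal M(\bar w^j)$; let $h^j$ be an iterate of the conjugate gradient method for $M_jh=-\nabla\varphi(\bar w^j)$, started at $0$, with $$\|M_jh^j+\nabla\varphi(\bar w^j)\|\le\min\{\nu,\|\nabla\varphi(\bar w^j)\|^{1+\tau}\};$$ let $\iota_j$ be the smallest integer $\iota\ge0$ with $\varphi(\bar w^j+\varpi^{\iota}h^j)\le\varphi(\bar w^j)+\varrho\varpi^{\iota}\langle\nabla\varphi(\bar w^j),h^j\rangle$; put $\bar w^{j+1}=\bar w^j+\varpi^{\iota_j}h^j$. **Theorem.** The function $\varphi$ is continuously differentiable and strongly convex with modulus $1/\sigma$. Every infinite sequence $\{\bar w^j\}$ generated by the algorithm (from an arbitrary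 starting point) converges to the unique minimizer $\hat w$ of $\varphi$ over $\mathbb R^t$, and, as $j\to\infty$, $$\|\bar w^{j+1}-\hat w\|=O\big(\|\bar w^j-\hat w\|^{1+\tau}\big).$$ In particular the rate is at least superlinear, $\|\bar w^{j+1}-\hat w\|=o(\|\bar w^j-\hat w\|)$, and it is quadratic, $\|\bar w^{j+1}-\hat w\|=O(\|\bar w^j-\hat w\|^2)$, if $\tau=1$. -/

import Mathlib

noncomputable section

namespace MTLasso

/-! ### Polyhedra, their projectors, and the generalized HS-Jacobian -/

/-- The polyhedron `{w | B w ≤ c}` in Euclidean space. -/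
def polyhedron {ρ κ : Type} [Fintype κ] (B : Matrix ρ κ ℝ) (c : ρ → ℝ) :
    Set (EuclideanSpace ℝ κ) :=
  {w | ∀ r, B.mulVec w.ofLp r ≤ c r}

/-- `p` is the metric projection of `q` onto the set `C`. -/
def IsProjection {E : Type} [NormedAddCommGroup E] (C : Set E) (q p : E) : Prop :=
  p ∈ C ∧ ∀ z ∈ C, ‖p - q‖ ≤ ‖z - q‖

/-- `μ ≥ 0` is a Lagrange multiplier (KKT conditions) for the projection `p` of `q` onto
`{w | B w ≤ c}`. -/
def IsMultiplier {ρ κ : Type} [Fintype ρ] [Fintype κ] (B : Matrix ρ κ ℝ) (c : ρ → ℝ)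
    (q p : EuclideanSpace ℝ κ) (μ : ρ → ℝ) : Prop :=
  (∀ r, 0 ≤ μ r) ∧
  p.ofLp - q.ofLp + B.transpose.mulVec μ = 0 ∧
  (∀ r, B.mulVec p.ofLp r - c r ≤ 0) ∧
  μ ⬝ᵥ (B.mulVec p.ofLp - c) = 0

/-- The submatrix `B_K` of the rows of `B` indexed by `K`. -/
def rowSub {ρ κ : Type} (B : Matrix ρ κ ℝ) (K : Finset ρ) : Matrix K κ ℝ :=
  B.submatrix (fun r : K => (r : ρ)) id

/-- The generalized HS-Jacobian at `q` of the projector onto `{w | B w ≤ c}`: all matrices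
`I - B_Kᵀ (B_K B_Kᵀ)⁻¹ B_K`, where `K` contains the support of some multiplier, is contained in
the set of active constraints at the projection of `q`, and `B_K` has full row rank. -/
def hsJacobian {ρ κ : Type} [Fintype ρ] [DecidableEq ρ] [Fintype κ] [DecidableEq κ]
    (B : Matrix ρ κ ℝ) (c : ρ → ℝ) (q : EuclideanSpace ℝ κ) : Set (Matrix κ κ ℝ) :=
  {N | ∃ (p : EuclideanSpace ℝ κ) (μ : ρ → ℝ) (K : Finset ρ),
    IsProjection (polyhedron B c) q p ∧
    IsMultiplier B c q p μ ∧
    (∀ r, μ r ≠ 0 → r ∈ K) ∧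
    (∀ r ∈ K, B.mulVec p.ofLp r = c r) ∧
    LinearIndependent ℝ (rowSub B K).row ∧
    N = 1 - (rowSub B K).transpose * (rowSub B K * (rowSub B K).transpose)⁻¹ * rowSub B K}

/-- The Moreau envelope of the indicator function of `C`:
`q ↦ inf_z {½ ‖z - q‖² + χ_C(z)}`, the infimum being over the points of `C`. -/
def moreauIndicator {E : Type} [NormedAddCommGroup E] (C : Set E) (q : E) : ℝ :=
  ⨅ z : C, (1 / 2) * ‖(z : E) - q‖ ^ 2

/-! ### The polyhedral description of the projection onto the `ℓ_{1,∞}`-ball -/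

open Classical in
/-- The matrix `T`: in row `i` the only entry that may be nonzero is `sign Q_{iλ}`, where `λ` is
the smallest column index at which `|Q_{i·}|` is maximal. -/
def leadSign {d n : ℕ} (Q : Matrix (Fin d) (Fin n) ℝ) : Matrix (Fin d) (Fin n) ℝ :=
  Matrix.of fun i j =>
    if IsLeast {k : Fin n | ∀ l, |Q i l| ≤ |Q i k|} j then Real.sign (Q i j) else 0

/-- `F = Diag(sign q)`; the coordinates of `Vec(Q)` are indexed by the pairs `(i, j)`. -/
def matF {d n : ℕ} (Q : Matrix (Fin d) (Fin n) ℝ) :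
    Matrix (Fin d × Fin n) (Fin d × Fin n) ℝ :=
  Matrix.diagonal fun k => Real.sign (Q k.1 k.2)

/-- `E`: row `i` is the vector with entry `T_{iλ_i}` at position `(i, λ_i)` and zero elsewhere. -/
def matE {d n : ℕ} (Q : Matrix (Fin d) (Fin n) ℝ) : Matrix (Fin d) (Fin d × Fin n) ℝ :=
  Matrix.of fun i k => if k.1 = i then leadSign Q i k.2 else 0

/-- `D = F - 𝟏ₙ ⊗ E`: from row `(i, j)` of `F` one subtracts row `i` of `E`. -/
def matD {d n : ℕ} (Q : Matrix (Fin d) (Fin n) ℝ) :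
    Matrix (Fin d × Fin n) (Fin d × Fin n) ℝ :=
  Matrix.of fun p k => matF Q p k - matE Q p.1 k

/-- Index type of the `2nd + 1` rows of `B`. -/
abbrev RowIdx (d n : ℕ) : Type := (Fin d × Fin n) ⊕ (Fin d × Fin n) ⊕ Unit

/-- `B = [-F; D; bᵀ]` with `b = Vec(T)`; all of this depends on the matrix `Q` to be projected. -/
def matB {d n : ℕ} (Q : Matrix (Fin d) (Fin n) ℝ) : Matrix (RowIdx d n) (Fin d × Fin n) ℝ :=
  Matrix.of fun r k => match r with
    | Sum.inl p => - matF Q p k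
    | Sum.inr (Sum.inl p) => matD Q p k
    | Sum.inr (Sum.inr _) => leadSign Q k.1 k.2

/-- `c = [0; γ]`. -/
def vecC (d n : ℕ) (γ : ℝ) : RowIdx d n → ℝ
  | Sum.inl _ => 0
  | Sum.inr (Sum.inl _) => 0
  | Sum.inr (Sum.inr _) => γ

/-- The `ℓ_{1,∞}`-norm `∑_i max_j |W_ij|`. -/
def norm1inf {d n : ℕ} (W : Matrix (Fin d) (Fin n) ℝ) : ℝ := ∑ i, ⨆ j, |W i j|

/-! ### The subproblem of the proximal augmented Lagrangian method -/

/-- The data of one (reduced) subproblem: `n` regression tasks `(X^i, y^i)` with `m i` samples and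
`d` features, the radius `γ > 0`, the index set `I` of the retained entries, the penalty parameter
`σ > 0`, and the given vectors `w̃, ũ`. -/
structure PALSubproblem (d n : ℕ) (m : Fin n → ℕ) where
  X : (i : Fin n) → Matrix (Fin (m i)) (Fin d) ℝ
  y : EuclideanSpace ℝ ((i : Fin n) × Fin (m i))
  γ : ℝ
  γ_pos : 0 < γ
  I : Finset (Fin d × Fin n)
  σ : ℝ
  σ_pos : 0 < σ
  wt : EuclideanSpace ℝ I
  ut : EuclideanSpace ℝ I

namespace PALSubproblem

variable {d n : ℕ} {m : Fin n → ℕ} (P : PALSubproblem d n m)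

/-- The space `ℝ^t`, `t = |I|`. -/
abbrev Space : Type := EuclideanSpace ℝ P.I

/-- `𝒬†`: extension of a vector in `ℝ^t` by zero to a `d × n` matrix. -/
def extend (w : P.Space) : Matrix (Fin d) (Fin n) ℝ :=
  Matrix.of fun i j => if h : (i, j) ∈ P.I then w ⟨(i, j), h⟩ else 0

/-- The columns indexed by `I` of the block diagonal matrix `X = Diag(X^1, …, X^n)`;
the column `(k, j)` multiplies the entry `W_{kj}`. -/
def XI : Matrix ((i : Fin n) × Fin (m i)) P.I ℝ :=
  Matrix.of fun p k => if p.1 = k.1.2 then P.X p.1 p.2 k.1.1 else 0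

/-- `B̄`: the columns indexed by `I` of the matrix `B` belonging to the (extended) point `q`. -/
def Bbar (q : P.Space) : Matrix (RowIdx d n) P.I ℝ :=
  (matB (P.extend q)).submatrix id (fun k : P.I => (k : Fin d × Fin n))

/-- `C̄ = {w | B̄ w ≤ c}`, belonging to the point `q` that is projected. -/
def Cbar (q : P.Space) : Set P.Space := polyhedron (P.Bbar q) (vecC d n P.γ)

/-- The point `w + ũ/σ`. -/
def shift (w : P.Space) : P.Space := w + P.σ⁻¹ • P.ut

/-- The objective function
`φ(w) = ½‖y - X_I w‖² - ‖ũ‖²/(2σ) + σ H_{χ_C̄}(w + ũ/σ) + ‖w - w̃‖²/(2σ)`. -/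
def φ (w : P.Space) : ℝ :=
  (1 / 2) * ‖P.y - WithLp.toLp 2 (P.XI.mulVec w.ofLp)‖ ^ 2
    - 1 / (2 * P.σ) * ‖P.ut‖ ^ 2
    + P.σ * moreauIndicator (P.Cbar (P.shift w)) (P.shift w)
    + 1 / (2 * P.σ) * ‖w - P.wt‖ ^ 2

/-- The surrogate generalized Hessian
`𝓜(w) = {X_Iᵀ X_I + σ (I - N̄) + σ⁻¹ I : N̄ in the HS-Jacobian of Π_C̄ at w + ũ/σ}`. -/
def 𝓜 (w : P.Space) : Set (Matrix P.I P.I ℝ) :=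
  {M | ∃ N ∈ hsJacobian (P.Bbar (P.shift w)) (vecC d n P.γ) (P.shift w),
    M = P.XI.transpose * P.XI + P.σ • (1 - N) + P.σ⁻¹ • (1 : Matrix P.I P.I ℝ)}

lemma sum_extend (z : P.Space) (f : Fin d × Fin n → ℝ) :
    ∑ k : P.I, f k * z k = ∑ k : Fin d × Fin n, f k * P.extend z k.1 k.2 := by
  have h1 : ∀ k : P.I, f k * z k = f k * P.extend z (k : Fin d × Fin n).1 (k : Fin d × Fin n).2 := by
    intro k; simp [extend]
  rw [Finset.sum_congr rfl (fun k _ => h1 k),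
    Finset.sum_coe_sort P.I (fun k => f k * P.extend z k.1 k.2)]
  refine Finset.sum_subset (Finset.subset_univ _) ?_
  intro k _ hk
  simp [extend, hk]

lemma mem_Cbar (q z : P.Space) : z ∈ P.Cbar q ↔
    (∀ i j, 0 ≤ Real.sign (P.extend q i j) * P.extend z i j) ∧
    (∀ i j, Real.sign (P.extend q i j) * P.extend z i j ≤
      ∑ l, leadSign (P.extend q) i l * P.extend z i l) ∧
    ∑ i, ∑ l, leadSign (P.extend q) i l * P.extend z i l ≤ P.γ := by
  have key : ∀ r, (P.Bbar q).mulVec z.ofLp r =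
      ∑ k : Fin d × Fin n, matB (P.extend q) r k * P.extend z k.1 k.2 := by
    intro r
    rw [← sum_extend]
    rfl
  have hF : ∀ i j, ∑ k : Fin d × Fin n, matF (P.extend q) (i, j) k * P.extend z k.1 k.2 =
      Real.sign (P.extend q i j) * P.extend z i j := by
    intro i j
    simp [matF, Matrix.diagonal_apply]
  have hE : ∀ i, ∑ k : Fin d × Fin n, matE (P.extend q) i k * P.extend z k.1 k.2 =
      ∑ l, leadSign (P.extend q) i l * P.extend z i l := by
    intro i
    rw [Fintype.sum_prod_type, Finset.sum_eq_single i]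
    · simp [matE]
    · intro b _ hb; simp [matE, hb]
    · simp
  constructor
  · intro h
    refine ⟨fun i j => ?_, fun i j => ?_, ?_⟩
    · have := h (Sum.inl (i, j))
      rw [key] at this
      simp only [matB, Matrix.of_apply, neg_mul, Finset.sum_neg_distrib, vecC] at this
      rw [hF] at this; linarith
    · have := h (Sum.inr (Sum.inl (i, j)))
      rw [key] at this
      simp only [matB, matD, Matrix.of_apply, sub_mul, Finset.sum_sub_distrib, vecC] at this
      rw [hF, hE] at this; linarith
    · have := h (Sum.inr (Sum.inr ()))
      rw [key, Fintype.sum_prod_type] at this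
      exact this
  · rintro ⟨h1, h2, h3⟩ (⟨i, j⟩ | ⟨i, j⟩ | u)
    · rw [key]
      simp only [matB, Matrix.of_apply, neg_mul, Finset.sum_neg_distrib, vecC]
      rw [hF]; linarith [h1 i j]
    · rw [key]
      simp only [matB, matD, Matrix.of_apply, sub_mul, Finset.sum_sub_distrib, vecC]
      rw [hF, hE]; linarith [h2 i j]
    · rw [key, Fintype.sum_prod_type]
      exact h3

lemma leadSign_sum (Q : Matrix (Fin d) (Fin n) ℝ) (i : Fin d) (j : Fin n) :
    ∃ a, (∀ l, |Q i l| ≤ |Q i a|) ∧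
      ∀ Z : Fin n → ℝ, ∑ l, leadSign Q i l * Z l = Real.sign (Q i a) * Z a := by
  have hne : {k : Fin n | ∀ l, |Q i l| ≤ |Q i k|}.Nonempty := by
    have : Nonempty (Fin n) := ⟨j⟩
    obtain ⟨k, hk⟩ := Finite.exists_max (fun l => |Q i l|)
    exact ⟨k, hk⟩
  obtain ⟨a, ha⟩ : ∃ a, IsLeast {k : Fin n | ∀ l, |Q i l| ≤ |Q i k|} a :=
    ⟨_, WellFounded.min_mem wellFounded_lt _ hne,
      fun b hb => not_lt.1 (WellFounded.not_lt_min wellFounded_lt _ hb)⟩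
  refine ⟨a, ha.1, fun Z => ?_⟩
  rw [Finset.sum_eq_single a]
  · simp [leadSign, ha]
  · intro b _ hb
    have : ¬ IsLeast {k : Fin n | ∀ l, |Q i l| ≤ |Q i k|} b := fun h => hb (h.unique ha)
    simp only [leadSign, Matrix.of_apply, if_neg this, zero_mul]
  · simp

/-- Although `C̄` depends on the point `q` to be projected, the Moreau envelope of its indicator at `q`
is that of the fixed convex set `{z | ‖𝒬† z‖_{1,∞} ≤ γ}`. -/
theorem moreauIndicator_Cbar (q : P.Space) :
    moreauIndicator (P.Cbar q) q =
      moreauIndicator {z : P.Space | norm1inf (P.extend z) ≤ P.γ} q := by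
  have bdd : ∀ C : Set P.Space,
      BddBelow (Set.range fun z : C => (1 / 2) * ‖(z : P.Space) - q‖ ^ 2) :=
    fun C => ⟨0, by rintro _ ⟨z, rfl⟩; positivity⟩
  have mono : ∀ C C' : Set P.Space, C'.Nonempty →
      (∀ z ∈ C', ∃ z' ∈ C, ‖z' - q‖ ≤ ‖z - q‖) → moreauIndicator C q ≤ moreauIndicator C' q := by
    intro C C' hn h
    have : Nonempty C' := hn.to_subtype
    refine le_ciInf fun z => ?_
    obtain ⟨z', hz', hle⟩ := h z z.2
    refine (ciInf_le (bdd C) ⟨z', hz'⟩).trans ?_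
    dsimp only
    gcongr
  have e0 : P.extend 0 = 0 := by ext i j; simp [extend]
  have nle : ∀ z z' : P.Space, (∀ k, |z' k - q k| ≤ |z k - q k|) → ‖z' - q‖ ≤ ‖z - q‖ := by
    intro z z' h
    rw [EuclideanSpace.norm_eq, EuclideanSpace.norm_eq]
    refine Real.sqrt_le_sqrt (Finset.sum_le_sum fun k _ => ?_)
    have := h k
    simp only [PiLp.sub_apply, Real.norm_eq_abs]
    gcongr
  apply le_antisymm
  · refine mono _ _ ⟨0, ?_⟩ ?_
    · simp [e0, norm1inf, P.γ_pos.le]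
    · intro z hz
      let θ : Fin d → ℝ := fun i => ⨆ j, |P.extend z i j|
      have hθ : ∀ i j, |P.extend z i j| ≤ θ i := fun i j =>
        le_ciSup (f := fun j => |P.extend z i j|) (Set.finite_range _).bddAbove j
      have hθ0 : ∀ i, 0 ≤ θ i := fun i => Real.iSup_nonneg fun j => abs_nonneg _
      let z' : P.Space := WithLp.toLp 2 fun k => Real.sign (q k) * min |q k| (θ k.1.1)
      have hz' : ∀ i j, P.extend z' i j =
          Real.sign (P.extend q i j) * min |P.extend q i j| (θ i) := by
        intro i j
        by_cases h : (i, j) ∈ P.I <;> simp [extend, h, z']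
      have hs : ∀ i j, Real.sign (P.extend q i j) * P.extend z' i j =
          min |P.extend q i j| (θ i) := by
        intro i j
        rw [hz']
        rcases lt_trichotomy (P.extend q i j) 0 with h | h | h
        · simp [Real.sign_of_neg h]
        · simp [h, hθ0]
        · simp [Real.sign_of_pos h]
      refine ⟨z', (P.mem_Cbar q z').2 ⟨fun i j => ?_, fun i j => ?_, ?_⟩, nle _ _ fun k => ?_⟩
      · rw [hs]; exact le_min (abs_nonneg _) (hθ0 i)
      · obtain ⟨a, ha, hsum⟩ := leadSign_sum (P.extend q) i j
        rw [hsum (fun l => P.extend z' i l), hs, hs]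
        exact min_le_min_right _ (ha j)
      · refine (Finset.sum_le_sum fun i _ => ?_).trans hz
        by_cases hn : Nonempty (Fin n)
        · obtain ⟨j⟩ := hn
          obtain ⟨a, ha, hsum⟩ := leadSign_sum (P.extend q) i j
          rw [hsum (fun l => P.extend z' i l), hs]
          exact min_le_right _ _
        · rw [not_nonempty_iff] at hn
          rw [Finset.univ_eq_empty, Finset.sum_empty]
          exact hθ0 i
      · have h1 := hθ k.1.1 k.1.2
        have h2 : P.extend z k.1.1 k.1.2 = z k := by simp [extend]
        rw [h2] at h1
        have h3 := abs_le.1 h1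
        change |Real.sign (q k) * min |q k| (θ k.1.1) - q k| ≤ _
        rcases lt_trichotomy (q k) 0 with h | h | h
        · rw [Real.sign_of_neg h, abs_of_neg h]
          rcases le_total (-q k) (θ k.1.1) with h4 | h4
          · simp [min_eq_left h4]
          · rw [min_eq_right h4]
            exact abs_le_abs (by linarith) (by linarith)
        · simp [h]
        · rw [Real.sign_of_pos h, abs_of_pos h]
          rcases le_total (q k) (θ k.1.1) with h4 | h4
          · simp [min_eq_left h4]
          · rw [min_eq_right h4, abs_sub_comm, abs_sub_comm (z k)]
            exact abs_le_abs (by linarith) (by linarith)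
  · refine mono _ _ ⟨0, ?_⟩ ?_
    · rw [mem_Cbar]; simp [e0, P.γ_pos.le]
    · intro z hz
      obtain ⟨h1, h2, h3⟩ := (P.mem_Cbar q z).1 hz
      let z' : P.Space := WithLp.toLp 2 fun k => if q k = 0 then 0 else z k
      have hz' : ∀ i j, P.extend z' i j = if P.extend q i j = 0 then 0 else P.extend z i j := by
        intro i j
        by_cases h : (i, j) ∈ P.I <;> simp [extend, h, z']
      refine ⟨z', ?_, nle _ _ fun k => ?_⟩
      · refine le_trans (Finset.sum_le_sum fun i _ => ?_) h3
        by_cases hn : Nonempty (Fin n)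
        · refine ciSup_le fun j => ?_
          rw [hz']
          split_ifs with h
          · rw [abs_zero]; exact (h1 i j).trans (h2 i j)
          · refine le_trans (le_of_eq ?_) (h2 i j)
            have := h1 i j
            rcases lt_or_gt_of_ne h with h | h
            · rw [Real.sign_of_neg h] at this ⊢
              rw [abs_of_nonpos (by linarith)]; ring
            · rw [Real.sign_of_pos h] at this ⊢
              rw [abs_of_nonneg (by linarith)]; ring
        · rw [not_nonempty_iff] at hn
          rw [Real.iSup_of_isEmpty, Finset.univ_eq_empty, Finset.sum_empty]
      · change |(if q k = 0 then 0 else z k) - q k| ≤ _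
        split_ifs with h
        · simp [h]
        · exact le_rfl
end PALSubproblem

/-! ### The conjugate gradient method -/

/-- State of the conjugate gradient method: iterate, residual, search direction. -/
structure CGState (E : Type) where
  x : E
  r : E
  p : E

/-- One step of the conjugate gradient method for `A x = b`. After the residual has become zero
the quotients are `0 / _ = 0`, and the iterate no longer changes. -/
def cgStep {E : Type} [NormedAddCommGroup E] [InnerProductSpace ℝ E] (A : E → E)
    (s : CGState E) : CGState E :=
  let a := inner ℝ s.r s.r / inner ℝ s.p (A s.p)
  let r' := s.r - a • A s.p
  let b := inner ℝ r' r' / inner ℝ s.r s.r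
  { x := s.x + a • s.p, r := r', p := r' + b • s.p }

/-- The conjugate gradient method for `A x = b`, started at `x = 0`. -/
def cgState {E : Type} [NormedAddCommGroup E] [InnerProductSpace ℝ E] (A : E → E) (b : E) :
    ℕ → CGState E
  | 0 => { x := 0, r := b, p := b }
  | k + 1 => cgStep A (cgState A b k)

/-! ### The semismooth Newton algorithm -/

/-- The action of a matrix on Euclidean space. -/
def act {κ : Type} [Fintype κ] (M : Matrix κ κ ℝ) (x : EuclideanSpace ℝ κ) :
    EuclideanSpace ℝ κ :=
  WithLp.toLp 2 (M.mulVec x.ofLp)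

/-- One iteration `w ↦ w'` of the semismooth Newton algorithm: `h` is an iterate of the conjugate
gradient method for `M h = -∇φ(w)` that meets the accuracy test, and the step length is found by
Armijo backtracking. -/
def IsSsnStep {d n : ℕ} {m : Fin n → ℕ} (P : PALSubproblem d n m) (ϱ ν τ ϖ : ℝ)
    (w w' : P.Space) : Prop :=
  ∃ M ∈ P.𝓜 w, ∃ h : P.Space,
    (∃ k : ℕ, h = (cgState (act M) (-gradient P.φ w) k).x) ∧
    ‖act M h + gradient P.φ w‖ ≤ min ν (‖gradient P.φ w‖ ^ (1 + τ)) ∧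
    ∃ ι : ℕ,
      IsLeast {i : ℕ | P.φ (w + ϖ ^ i • h) ≤
        P.φ w + ϱ * ϖ ^ i * inner ℝ (gradient P.φ w) h} ι ∧
      w' = w + ϖ ^ ι • h

/-- `w` is an infinite sequence generated by the semismooth Newton algorithm. -/
def IsSsnSequence {d n : ℕ} {m : Fin n → ℕ} (P : PALSubproblem d n m) (ϱ ν τ ϖ : ℝ)
    (w : ℕ → P.Space) : Prop :=
  ∀ j, IsSsnStep P ϱ ν τ ϖ (w j) (w (j + 1))

end MTLasso

end

/-!
The function `φ` lies between quadratic models with second-order coefficients `σ⁻¹` and `L` at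
every point, because the squared distance to a closed convex set does so with coefficients `0` and
`1`. The first step of the conjugate gradient method already yields a fixed proportion of the
decrease available to the Newton model, and the later ones only improve on it. So every direction
is one of sufficient descent, the Armijo step lengths are bounded below, and the gradients tend to
zero. As the gradient of `φ` is a closed embedding, the iterates converge.

For the rate, projecting `q` onto `C̄(q)` amounts to projecting onto the `ℓ_{1,∞}`-ball, and only
finitely many matrices `B̄` and index sets `K` occur. On the set of the points `q` whose projection
onto the affine hull `{z | B̄_K z = c_K}` of a face is feasible and has nonnegative multipliers, the
projector is affine with linear part `1 - B̄_Kᵀ (B̄_K B̄_Kᵀ)⁻¹ B̄_K`. This set is closed, so if it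
contains points arbitrarily close to `x`, then it contains `x`. Hence near `x` each element of the
HS-Jacobian reproduces the increment of the projector from `x` without error, and `φ` and its
gradient have second-order expansions without remainder. The residual test then gives the order
`1 + τ` for full Newton steps, and the Armijo rule accepts these close to the minimizer.
-/

noncomputable section

namespace MTLasso

open Filter Topology Asymptotics
open scoped InnerProductSpace Matrix Pointwise

/-! ### The conjugate gradient method -/

section ConjugateGradient

variable {E : Type} [NormedAddCommGroup E] [InnerProductSpace ℝ E] {A : E →ₗ[ℝ] E}

/-- The quadratic function whose minimizer over a growing Krylov space is the conjugate gradient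
iterate for `A x = b`; it measures the progress of the method. -/
def cgEnergy (A : E →ₗ[ℝ] E) (b x : E) : ℝ := 1 / 2 * ⟪x, A x⟫_ℝ - ⟪b, x⟫_ℝ

lemma cgEnergy_add_smul (hA : A.IsSymmetric) (b x p : E) (a : ℝ) :
    cgEnergy A b (x + a • p) =
      cgEnergy A b x - a * ⟪b - A x, p⟫_ℝ + a ^ 2 / 2 * ⟪p, A p⟫_ℝ := by
  have hxp : ⟪x, A p⟫_ℝ = ⟪A x, p⟫_ℝ := (hA x p).symm
  have hpx : ⟪p, A x⟫_ℝ = ⟪A x, p⟫_ℝ := real_inner_comm _ _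
  simp only [cgEnergy, map_add, map_smul, inner_add_left, inner_add_right, real_inner_smul_left,
    real_inner_smul_right, inner_sub_left, hxp, hpx]
  ring

lemma cgState_residual (A : E →ₗ[ℝ] E) (b : E) (k : ℕ) :
    (cgState A b k).r = b - A (cgState A b k).x := by
  induction k with
  | zero => simp [cgState]
  | succ k ih =>
    simp only [cgState, cgStep, map_add, map_smul, ih]
    abel

lemma inner_cgState_residual_direction (hpos : ∀ v, v ≠ 0 → 0 < ⟪v, A v⟫_ℝ) (b : E) (k : ℕ) :
    ⟪(cgState A b k).r, (cgState A b k).p⟫_ℝ = ⟪(cgState A b k).r, (cgState A b k).r⟫_ℝ := by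
  induction k with
  | zero => rfl
  | succ k ih =>
    simp only [cgState, cgStep]
    set s := cgState A b k
    have residual_orthogonal :
        ⟪s.r - (⟪s.r, s.r⟫_ℝ / ⟪s.p, A s.p⟫_ℝ) • A s.p, s.p⟫_ℝ = 0 := by
      rcases eq_or_ne s.p 0 with hp | hp
      · simp [hp]
      · rw [inner_sub_left, real_inner_smul_left, ih, real_inner_comm s.p (A s.p),
          div_mul_cancel₀ _ (hpos _ hp).ne', sub_self]
    rw [inner_add_right, real_inner_smul_right, residual_orthogonal, mul_zero, add_zero]

lemma cgEnergy_cgState_succ (hA : A.IsSymmetric) (hpos : ∀ v, v ≠ 0 → 0 < ⟪v, A v⟫_ℝ) (b : E)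
    (k : ℕ) :
    cgEnergy A b (cgState A b (k + 1)).x = cgEnergy A b (cgState A b k).x -
      ⟪(cgState A b k).r, (cgState A b k).r⟫_ℝ ^ 2 /
        (2 * ⟪(cgState A b k).p, A (cgState A b k).p⟫_ℝ) := by
  simp only [cgState, cgStep]
  rw [cgEnergy_add_smul hA, ← cgState_residual, inner_cgState_residual_direction hpos]
  rcases eq_or_ne ⟪(cgState A b k).p, A (cgState A b k).p⟫_ℝ 0 with hp | hp
  · simp [hp]
  · field_simp
    ring

lemma cgEnergy_cgState_one_le (hA : A.IsSymmetric) (hpos : ∀ v, v ≠ 0 → 0 < ⟪v, A v⟫_ℝ) {b : E}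
    {L : ℝ} (hL : ⟪b, A b⟫_ℝ ≤ L * ‖b‖ ^ 2) :
    cgEnergy A b (cgState A b 1).x ≤ -(‖b‖ ^ 2 / (2 * L)) := by
  rw [cgEnergy_cgState_succ hA hpos]
  simp only [cgState, cgEnergy, map_zero, inner_zero_right, mul_zero, sub_self, zero_sub,
    real_inner_self_eq_norm_sq, neg_le_neg_iff]
  rcases eq_or_ne b 0 with rfl | hb
  · simp
  · have hbA := hpos b hb
    have hL_pos : 0 < L := pos_of_mul_pos_left (hbA.trans_le hL) (sq_nonneg _)
    rw [div_le_div_iff₀ (by positivity) (by positivity)]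
    nlinarith [sq_nonneg ‖b‖]

lemma cgEnergy_cgState_antitone (hA : A.IsSymmetric) (hpos : ∀ v, v ≠ 0 → 0 < ⟪v, A v⟫_ℝ)
    (b : E) : Antitone fun k => cgEnergy A b (cgState A b k).x := by
  refine antitone_nat_of_succ_le fun k => ?_
  have hp : 0 ≤ ⟪(cgState A b k).p, A (cgState A b k).p⟫_ℝ := by
    rcases eq_or_ne (cgState A b k).p 0 with h | h
    · simp [h]
    · exact (hpos _ h).le
  rw [cgEnergy_cgState_succ hA hpos]
  exact sub_le_self _ (by positivity)

theorem cgEnergy_cgState_le (hA : A.IsSymmetric) (hpos : ∀ v, v ≠ 0 → 0 < ⟪v, A v⟫_ℝ) {b : E}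
    {L : ℝ} (hL : ⟪b, A b⟫_ℝ ≤ L * ‖b‖ ^ 2) {k : ℕ} (hk : k ≠ 0) :
    cgEnergy A b (cgState A b k).x ≤ -(‖b‖ ^ 2 / (2 * L)) :=
  (cgEnergy_cgState_antitone hA hpos b (Nat.one_le_iff_ne_zero.2 hk)).trans
    (cgEnergy_cgState_one_le hA hpos hL)

end ConjugateGradient

/-! ### Functions between two quadratic models -/

section QuadraticBounds

/-- At every point the affine model of `F` with slope `G` underestimates `F` by at least
`l / 2 * ‖·‖ ^ 2` and by at most `L / 2 * ‖·‖ ^ 2`. For `0 ≤ l` and `0 < L` this says that `F` is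
differentiable with gradient `G`, strongly convex with modulus `l`, and that `G` is
`L`-Lipschitz. -/
structure HasQuadraticBounds {E : Type*} [NormedAddCommGroup E] [InnerProductSpace ℝ E] (l L : ℝ)
    (F : E → ℝ) (G : E → E) : Prop where
  lower : ∀ w v, F w + ⟪G w, v - w⟫_ℝ + l / 2 * ‖v - w‖ ^ 2 ≤ F v
  upper : ∀ w v, F v ≤ F w + ⟪G w, v - w⟫_ℝ + L / 2 * ‖v - w‖ ^ 2

variable {E : Type*} [NormedAddCommGroup E] [InnerProductSpace ℝ E]

lemma mul_norm_le_norm_of_mul_sq_norm_le_inner {l : ℝ} {v a : E} (h : l * ‖v‖ ^ 2 ≤ ⟪v, a⟫_ℝ) :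
    l * ‖v‖ ≤ ‖a‖ := by
  rcases (norm_nonneg v).eq_or_lt with hv | hv
  · simp [← hv]
  · refine le_of_mul_le_mul_left ?_ hv
    linarith [real_inner_le_norm v a]

namespace HasQuadraticBounds

variable {F F' : E → ℝ} {G G' : E → E} {l L l' L' : ℝ}

lemma add (H : HasQuadraticBounds l L F G) (H' : HasQuadraticBounds l' L' F' G') :
    HasQuadraticBounds (l + l') (L + L') (F + F') (G + G') where
  lower w v := by
    simp only [Pi.add_apply, inner_add_left]
    linarith [H.lower w v, H'.lower w v]
  upper w v := by
    simp only [Pi.add_apply, inner_add_left]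
    linarith [H.upper w v, H'.upper w v]

lemma const_smul (H : HasQuadraticBounds l L F G) {c : ℝ} (hc : 0 ≤ c) :
    HasQuadraticBounds (c * l) (c * L) (c • F) (c • G) where
  lower w v := by
    simp only [Pi.smul_apply, smul_eq_mul, real_inner_smul_left]
    linarith [mul_le_mul_of_nonneg_left (H.lower w v) hc]
  upper w v := by
    simp only [Pi.smul_apply, smul_eq_mul, real_inner_smul_left]
    linarith [mul_le_mul_of_nonneg_left (H.upper w v) hc]

lemma add_const (H : HasQuadraticBounds l L F G) (c : ℝ) :
    HasQuadraticBounds l L (fun w => F w + c) G where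
  lower w v := by linarith [H.lower w v]
  upper w v := by linarith [H.upper w v]

lemma comp_add_right (H : HasQuadraticBounds l L F G) (a : E) :
    HasQuadraticBounds l L (fun w => F (w + a)) (fun w => G (w + a)) where
  lower w v := by simpa using H.lower (w + a) (v + a)
  upper w v := by simpa using H.upper (w + a) (v + a)

protected lemma hasFDerivAt (H : HasQuadraticBounds l L F G) (w : E) :
    HasFDerivAt F (innerSL ℝ (G w)) w := by
  have remainder : (fun v => F v - F w - innerSL ℝ (G w) (v - w)) =O[𝓝 w]
      fun v => ‖v - w‖ ^ 2 := by
    refine IsBigO.of_bound (max |l / 2| |L / 2|) (Eventually.of_forall fun v => ?_)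
    have hl : -(max |l / 2| |L / 2|) ≤ l / 2 :=
      neg_le.1 ((neg_le_abs _).trans (le_max_left _ _))
    have hL : L / 2 ≤ max |l / 2| |L / 2| := (le_abs_self _).trans (le_max_right _ _)
    rw [innerSL_apply_apply, Real.norm_eq_abs, Real.norm_of_nonneg (sq_nonneg ‖v - w‖), abs_le]
    constructor
    · linarith [H.lower w v, mul_le_mul_of_nonneg_right hl (sq_nonneg ‖v - w‖)]
    · linarith [H.upper w v, mul_le_mul_of_nonneg_right hL (sq_nonneg ‖v - w‖)]
  exact .of_isLittleO (remainder.trans_isLittleO (isLittleO_pow_sub_sub w one_lt_two))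

lemma gradient_eq [CompleteSpace E] (H : HasQuadraticBounds l L F G) (w : E) :
    gradient F w = G w :=
  HasGradientAt.gradient (hasGradientAt_iff_hasFDerivAt.2 (H.hasFDerivAt w))

/-- Cocoercivity of `G`, obtained by comparing the lower model at `w` and the upper model at `v`
at the point `v - L⁻¹ • (G v - G w)`. -/
lemma norm_sub_sq_le_inner (H : HasQuadraticBounds l L F G) (hl : 0 ≤ l) (hL : 0 < L) (v w : E) :
    ‖G v - G w‖ ^ 2 ≤ L * ⟪G v - G w, v - w⟫_ℝ := by
  have gap (v w : E) : F w + ⟪G w, v - w⟫_ℝ + ‖G v - G w‖ ^ 2 / (2 * L) ≤ F v := by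
    set D := G v - G w with hD
    have low := H.lower w (v - L⁻¹ • D)
    have up := H.upper v (v - L⁻¹ • D)
    have hDD : ⟪G v, D⟫_ℝ - ⟪G w, D⟫_ℝ = ‖D‖ ^ 2 := by
      rw [← inner_sub_left, ← hD, real_inner_self_eq_norm_sq]
    rw [sub_sub_cancel_left, inner_neg_right, real_inner_smul_right, norm_neg, norm_smul,
      Real.norm_of_nonneg (inv_nonneg.2 hL.le), mul_pow] at up
    rw [sub_right_comm, inner_sub_right, real_inner_smul_right] at low
    have hlow : 0 ≤ l / 2 * ‖v - w - L⁻¹ • D‖ ^ 2 := by positivity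
    have scale : L / 2 * (L⁻¹ ^ 2 * ‖D‖ ^ 2) = L⁻¹ * ‖D‖ ^ 2 - ‖D‖ ^ 2 / (2 * L) := by
      field_simp
      ring
    linarith [congrArg (L⁻¹ * ·) hDD]
  have h₁ := gap v w
  have h₂ := gap w v
  rw [← neg_sub v w, inner_neg_right, norm_sub_rev] at h₂
  have hsum : ‖G v - G w‖ ^ 2 / L ≤ ⟪G v - G w, v - w⟫_ℝ := by
    rw [inner_sub_left]
    have halves : ‖G v - G w‖ ^ 2 / L = 2 * (‖G v - G w‖ ^ 2 / (2 * L)) := by field_simp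
    linarith
  rwa [div_le_iff₀' hL] at hsum

lemma lipschitzWith (H : HasQuadraticBounds l L F G) (hl : 0 ≤ l) (hL : 0 < L) :
    LipschitzWith L.toNNReal G := by
  refine LipschitzWith.of_dist_le_mul fun v w => ?_
  rw [dist_eq_norm, dist_eq_norm, Real.coe_toNNReal L hL.le]
  have h := mul_norm_le_norm_of_mul_sq_norm_le_inner (l := 1) (v := G v - G w)
    (a := L • (v - w)) (by
      rw [one_mul, real_inner_smul_right]
      exact H.norm_sub_sq_le_inner hl hL v w)
  rwa [one_mul, norm_smul, Real.norm_of_nonneg hL.le] at h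

lemma contDiff_one (H : HasQuadraticBounds l L F G) (hl : 0 ≤ l) (hL : 0 < L) :
    ContDiff ℝ 1 F := by
  refine contDiff_one_iff_fderiv.2 ⟨fun w => (H.hasFDerivAt w).differentiableAt, ?_⟩
  rw [show fderiv ℝ F = fun w => innerSL ℝ (G w) from funext fun w => (H.hasFDerivAt w).fderiv]
  exact (innerSL ℝ).continuous.comp (H.lipschitzWith hl hL).continuous

lemma strongConvexOn (H : HasQuadraticBounds l L F G) : StrongConvexOn Set.univ l F := by
  refine ⟨convex_univ, fun x _ y _ a b ha hb hab => ?_⟩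
  obtain rfl : a = 1 - b := eq_sub_of_add_eq hab
  set z := (1 - b) • x + b • y with hz
  have hx : x - z = b • (x - y) := by rw [hz]; module
  have hy : y - z = -((1 - b) • (x - y)) := by rw [hz]; module
  have at_x := H.lower z x
  have at_y := H.lower z y
  rw [hx, real_inner_smul_right, norm_smul, mul_pow, Real.norm_eq_abs, sq_abs] at at_x
  rw [hy, inner_neg_right, real_inner_smul_right, norm_neg, norm_smul, mul_pow, Real.norm_eq_abs,
    sq_abs] at at_y
  have average := add_le_add (mul_le_mul_of_nonneg_left at_x ha) (mul_le_mul_of_nonneg_left at_y hb)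
  simp only [smul_eq_mul]
  linarith

lemma mul_norm_sub_le (H : HasQuadraticBounds l L F G) (v w : E) :
    l * ‖v - w‖ ≤ ‖G v - G w‖ := by
  refine mul_norm_le_norm_of_mul_sq_norm_le_inner ?_
  have h₁ := H.lower w v
  have h₂ := H.lower v w
  rw [← neg_sub v w, inner_neg_right, norm_neg] at h₂
  rw [real_inner_comm, inner_sub_left]
  linarith

lemma antilipschitzWith (H : HasQuadraticBounds l L F G) (hl : 0 < l) :
    AntilipschitzWith l⁻¹.toNNReal G :=
  AntilipschitzWith.of_le_mul_dist fun v w => by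
    rw [dist_eq_norm, dist_eq_norm, Real.coe_toNNReal _ (inv_nonneg.2 hl.le), inv_mul_eq_div,
      le_div_iff₀' hl]
    exact H.mul_norm_sub_le v w

lemma sub_le (H : HasQuadraticBounds l L F G) (hl : 0 < l) (w v : E) :
    F w - ‖G w‖ ^ 2 / (2 * l) ≤ F v := by
  have cauchy_schwarz := neg_le_of_abs_le (abs_real_inner_le_norm (G w) (v - w))
  have square : ‖G w‖ * ‖v - w‖ ≤ ‖G w‖ ^ 2 / (2 * l) + l / 2 * ‖v - w‖ ^ 2 := by
    have expand : ‖G w‖ ^ 2 / (2 * l) + l / 2 * ‖v - w‖ ^ 2 - ‖G w‖ * ‖v - w‖ =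
        (‖G w‖ - l * ‖v - w‖) ^ 2 / (2 * l) := by
      field_simp
      ring
    have : 0 ≤ (‖G w‖ - l * ‖v - w‖) ^ 2 / (2 * l) := by positivity
    linarith
  linarith [H.lower w v]

lemma le_of_eq_zero (H : HasQuadraticBounds l L F G) (hl : 0 ≤ l) {x : E} (hx : G x = 0) (v : E) :
    F x ≤ F v := by
  have h := H.lower x v
  rw [hx, inner_zero_left, add_zero] at h
  exact le_of_add_le_of_nonneg_left h (by positivity)

lemma eq_zero_of_forall_le (H : HasQuadraticBounds l L F G) {x : E} (hx : ∀ v, F x ≤ F v) :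
    G x = 0 := by
  have h : innerSL ℝ (G x) = 0 :=
    IsLocalMin.hasFDerivAt_eq_zero (Eventually.of_forall hx) (H.hasFDerivAt x)
  simpa using congrArg (· (G x)) h

lemma eq_of_eq_zero (H : HasQuadraticBounds l L F G) (hl : 0 < l) {x v : E} (hx : G x = 0)
    (hv : G v = 0) : v = x :=
  (H.antilipschitzWith hl).injective (hv.trans hx.symm)

end HasQuadraticBounds

end QuadraticBounds

/-! ### Exact quadratic expansions -/

section ExactExpansion

/-- Between `x` and `w` the function `F` with gradient `G` behaves like a quadratic function with
Hessian `A`: the second-order expansions of `F` and `G` at `x` have no remainder at `w`. -/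
structure HasExactExpansion {E : Type*} [NormedAddCommGroup E] [InnerProductSpace ℝ E] (F : E → ℝ)
    (G : E → E) (A : E →L[ℝ] E) (x w : E) : Prop where
  map_eq : F w = F x + ⟪G x, w - x⟫_ℝ + 1 / 2 * ⟪w - x, A (w - x)⟫_ℝ
  grad_eq : G w = G x + A (w - x)

variable {E : Type*} [NormedAddCommGroup E] [InnerProductSpace ℝ E]

namespace HasExactExpansion

variable {F F' : E → ℝ} {G G' : E → E} {A A' : E →L[ℝ] E} {x w : E}

lemma add (H : HasExactExpansion F G A x w) (H' : HasExactExpansion F' G' A' x w) :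
    HasExactExpansion (F + F') (G + G') (A + A') x w where
  map_eq := by
    simp only [Pi.add_apply, add_apply, inner_add_left, inner_add_right, H.map_eq, H'.map_eq]
    ring
  grad_eq := by
    simp only [Pi.add_apply, add_apply, H.grad_eq, H'.grad_eq]
    abel

lemma const_smul (H : HasExactExpansion F G A x w) (c : ℝ) :
    HasExactExpansion (c • F) (c • G) (c • A) x w where
  map_eq := by
    simp only [Pi.smul_apply, smul_eq_mul, smul_apply, real_inner_smul_left,
      real_inner_smul_right, H.map_eq]
    ring
  grad_eq := by
    simp only [Pi.smul_apply, smul_apply, H.grad_eq, smul_add]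

lemma add_const (H : HasExactExpansion F G A x w) (c : ℝ) :
    HasExactExpansion (fun v => F v + c) G A x w where
  map_eq := by linarith [H.map_eq]
  grad_eq := H.grad_eq

lemma comp_add_right {a : E} (H : HasExactExpansion F G A (x + a) (w + a)) :
    HasExactExpansion (fun v => F (v + a)) (fun v => G (v + a)) A x w where
  map_eq := by simpa using H.map_eq
  grad_eq := by simpa using H.grad_eq

end HasExactExpansion

lemma mul_sq_norm_le_inner_of_smul_one_le {A : E →L[ℝ] E} {l : ℝ} (hA : l • 1 ≤ A) (v : E) :
    l * ‖v‖ ^ 2 ≤ ⟪v, A v⟫_ℝ := by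
  have h := ((ContinuousLinearMap.le_def _ _).1 hA).inner_nonneg_right v
  rwa [sub_apply, inner_sub_right, smul_apply,
    one_apply_eq_self, real_inner_smul_right, real_inner_self_eq_norm_sq,
    sub_nonneg] at h

lemma isSymmetric_of_smul_one_le {A : E →L[ℝ] E} {l : ℝ} (hA : l • 1 ≤ A) :
    (A : E →ₗ[ℝ] E).IsSymmetric := by
  have h := (((ContinuousLinearMap.le_def _ _).1 hA).isSymmetric).add
    ((LinearMap.IsSymmetric.id (𝕜 := ℝ) (E := E)).smul (c := l) (by simp))
  convert h using 1
  ext v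
  simp

lemma inner_map_self_le_of_norm_le {A : E →L[ℝ] E} {L : ℝ} (hA : ‖A‖ ≤ L) (v : E) :
    ⟪v, A v⟫_ℝ ≤ L * ‖v‖ ^ 2 :=
  calc ⟪v, A v⟫_ℝ ≤ ‖v‖ * ‖A v‖ := real_inner_le_norm _ _
    _ ≤ ‖v‖ * (L * ‖v‖) := by gcongr; exact A.le_of_opNorm_le hA v
    _ = L * ‖v‖ ^ 2 := by ring

lemma HasQuadraticBounds.of_hasExactExpansion {F : E → ℝ} {G : E → E} {A : E →L[ℝ] E} {l L : ℝ}
    (H : ∀ x w, HasExactExpansion F G A x w) (hl : l • 1 ≤ A) (hL : ‖A‖ ≤ L) :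
    HasQuadraticBounds l L F G where
  lower w v := by linarith [(H w v).map_eq, mul_sq_norm_le_inner_of_smul_one_le hl (v - w)]
  upper w v := by linarith [(H w v).map_eq, inner_map_self_le_of_norm_le hL (v - w)]

lemma hasExactExpansion_half_sq_norm_sub (a x w : E) :
    HasExactExpansion (fun v => 1 / 2 * ‖v - a‖ ^ 2) (fun v => v - a) 1 x w where
  map_eq := by
    have h := norm_add_sq_real (x - a) (w - x)
    rw [sub_add_sub_cancel'] at h
    rw [one_apply_eq_self, real_inner_self_eq_norm_sq, h]
    ring
  grad_eq := by simp

lemma hasExactExpansion_leastSquares {E' : Type*} [NormedAddCommGroup E']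
    [InnerProductSpace ℝ E'] [CompleteSpace E] [CompleteSpace E'] (T : E →L[ℝ] E') (y : E')
    (x w : E) :
    HasExactExpansion (fun v => 1 / 2 * ‖y - T v‖ ^ 2) (fun v => T.adjoint (T v - y))
      (T.adjoint ∘L T) x w where
  map_eq := by
    have hw : y - T w = y - T x - T (w - x) := by simp
    rw [hw, norm_sub_sq_real, ContinuousLinearMap.adjoint_inner_left,
      ContinuousLinearMap.comp_apply, ContinuousLinearMap.adjoint_inner_right,
      real_inner_self_eq_norm_sq, ← neg_sub y (T x), inner_neg_left]
    ring
  grad_eq := by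
    rw [ContinuousLinearMap.comp_apply, ← map_add, map_sub T w x]
    congr 1
    abel

end ExactExpansion

/-! ### The inexact Newton method with Armijo backtracking -/

section NewtonMethod

lemma eq_zero_of_norm_le_min {V : Type*} [NormedAddCommGroup V] {g : V} {ν τ : ℝ} (hν : ν < 1)
    (hτ : 0 < τ) (h : ‖g‖ ≤ min ν (‖g‖ ^ (1 + τ))) : g = 0 := by
  by_contra hg
  have hlt_one : ‖g‖ < 1 := (h.trans (min_le_left _ _)).trans_lt hν
  exact (h.trans (min_le_right _ _)).not_gt
    (Real.rpow_lt_self_of_lt_one (norm_pos_iff.2 hg) hlt_one (by linarith))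

lemma isLittleO_rpow_one_add {α : Type*} {f : Filter α} {u : α → ℝ} {τ : ℝ} (hu : ∀ a, 0 ≤ u a)
    (hτ : 0 < τ) (hlim : Tendsto u f (𝓝 0)) : (fun a => u a ^ (1 + τ)) =o[f] u := by
  have hτ_lim : Tendsto (fun a => u a ^ τ) f (𝓝 0) := by
    simpa [Real.zero_rpow hτ.ne'] using hlim.rpow_const (p := τ) (Or.inr hτ.le)
  refine (((isLittleO_one_iff ℝ).2 hτ_lim).mul_isBigO (isBigO_refl u f)).congr (fun a => ?_)
    fun a => one_mul _
  rw [add_comm, Real.rpow_add_one' (hu a) (by linarith)]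

variable {E : Type} [NormedAddCommGroup E] [InnerProductSpace ℝ E]

/-- The exponents `i` for which the step `ϖ ^ i • h` from `w` satisfies the Armijo condition with
parameter `ϱ`, where `g` is the gradient of `F` at `w`. -/
def armijoExponents (F : E → ℝ) (ϱ ϖ : ℝ) (w g h : E) : Set ℕ :=
  {i | F (w + ϖ ^ i • h) ≤ F w + ϱ * ϖ ^ i * ⟪g, h⟫_ℝ}

/-- One iteration `w ↦ w'` of the inexact Newton method for minimizing `F` with gradient `G`, where
`Ms w` is the set of the admissible surrogates of the Hessian at `w`. -/
def IsNewtonStep (F : E → ℝ) (G : E → E) (Ms : E → Set (E →L[ℝ] E)) (ϱ ν τ ϖ : ℝ) (w w' : E) :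
    Prop :=
  ∃ A ∈ Ms w, ∃ h : E,
    (∃ k : ℕ, h = (cgState A (-G w) k).x) ∧
    ‖A h + G w‖ ≤ min ν (‖G w‖ ^ (1 + τ)) ∧
    ∃ ι : ℕ, IsLeast (armijoExponents F ϱ ϖ w (G w) h) ι ∧ w' = w + ϖ ^ ι • h

lemma half_sq_norm_add_le_neg_inner_cgState {A : E →L[ℝ] E} {l L : ℝ} (hl : 0 < l)
    (hA : l • 1 ≤ A) (hAL : ‖A‖ ≤ L) (g : E) {k : ℕ} (hk : k ≠ 0) :
    l / 2 * ‖(cgState A (-g) k).x‖ ^ 2 + ‖g‖ ^ 2 / (2 * L) ≤ -⟪g, (cgState A (-g) k).x⟫_ℝ := by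
  have hpos (v : E) (hv : v ≠ 0) : 0 < ⟪v, A v⟫_ℝ :=
    (by positivity : 0 < l * ‖v‖ ^ 2).trans_le (mul_sq_norm_le_inner_of_smul_one_le hA v)
  have energy := cgEnergy_cgState_le (A := (A : E →ₗ[ℝ] E)) (isSymmetric_of_smul_one_le hA) hpos
    (inner_map_self_le_of_norm_le hAL (-g)) hk
  simp only [cgEnergy, ContinuousLinearMap.coe_coe, norm_neg, inner_neg_left] at energy
  linarith [mul_sq_norm_le_inner_of_smul_one_le hA (cgState A (-g) k).x]

/-- The initial iterate `0` of the conjugate gradient method passes the accuracy test only if the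
gradient vanishes, so the search direction is always one of descent. -/
lemma half_sq_norm_add_le_neg_inner {A : E →L[ℝ] E} {l L ν τ : ℝ} (hl : 0 < l)
    (hA : l • 1 ≤ A) (hAL : ‖A‖ ≤ L) (hν : ν < 1) (hτ : 0 < τ) {g h : E} {k : ℕ}
    (hk : h = (cgState A (-g) k).x) (hres : ‖A h + g‖ ≤ min ν (‖g‖ ^ (1 + τ))) :
    l / 2 * ‖h‖ ^ 2 + ‖g‖ ^ 2 / (2 * L) ≤ -⟪g, h⟫_ℝ := by
  rcases eq_or_ne k 0 with rfl | hk0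
  · obtain rfl : h = 0 := hk
    rw [map_zero, zero_add] at hres
    simp [eq_zero_of_norm_le_min hν hτ hres]
  · exact hk ▸ half_sq_norm_add_le_neg_inner_cgState hl hA hAL g hk0

namespace HasQuadraticBounds

variable {F : E → ℝ} {G : E → E} {l L ϱ ν τ ϖ : ℝ} {Ms : E → Set (E →L[ℝ] E)}

lemma mul_lt_of_armijo_fails (H : HasQuadraticBounds l L F G) (hϱ : ϱ < 1) {w h : E} {t : ℝ}
    (ht : 0 < t) (hd : l / 2 * ‖h‖ ^ 2 ≤ -⟪G w, h⟫_ℝ)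
    (hfail : F w + ϱ * t * ⟪G w, h⟫_ℝ < F (w + t • h)) : (1 - ϱ) * l < L * t := by
  have model := H.upper w (w + t • h)
  rw [add_sub_cancel_left, real_inner_smul_right, norm_smul, mul_pow, Real.norm_eq_abs,
    sq_abs] at model
  have gap : 0 < t * ((1 - ϱ) * ⟪G w, h⟫_ℝ + L / 2 * t * ‖h‖ ^ 2) := by linarith
  have slope : 0 < (L * t - (1 - ϱ) * l) * ‖h‖ ^ 2 := by
    have := pos_of_mul_pos_right gap ht.le
    have := mul_le_mul_of_nonneg_left hd (sub_nonneg.2 hϱ.le)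
    linarith
  exact sub_pos.1 (pos_of_mul_pos_left slope (sq_nonneg _))

lemma le_armijo_stepLength (H : HasQuadraticBounds l L F G) (hl : 0 < l) (hlL : l ≤ L)
    (hϱ₀ : 0 ≤ ϱ) (hϱ₁ : ϱ < 1) (hϖ₀ : 0 < ϖ) (hϖ₁ : ϖ ≤ 1) {w h : E}
    (hd : l / 2 * ‖h‖ ^ 2 ≤ -⟪G w, h⟫_ℝ) {ι : ℕ}
    (hι : IsLeast (armijoExponents F ϱ ϖ w (G w) h) ι) : ϖ * ((1 - ϱ) * (l / L)) ≤ ϖ ^ ι := by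
  have hL : 0 < L := hl.trans_le hlL
  cases ι with
  | zero =>
    rw [pow_zero]
    exact mul_le_one₀ hϖ₁ (mul_nonneg (by linarith) (by positivity))
      (mul_le_one₀ (by linarith) (by positivity) ((div_le_one hL).2 hlL))
  | succ i =>
    have hfail : F w + ϱ * ϖ ^ i * ⟪G w, h⟫_ℝ < F (w + ϖ ^ i • h) :=
      not_le.1 fun hi => (hι.2 hi).not_gt i.lt_succ_self
    have h := H.mul_lt_of_armijo_fails hϱ₁ (pow_pos hϖ₀ i) hd hfail
    rw [pow_succ', ← mul_div_assoc]
    gcongr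
    exact (div_le_iff₀' hL).2 h.le

lemma sufficient_decrease (H : HasQuadraticBounds l L F G) (hl : 0 < l) (hlL : l ≤ L)
    (hM : ∀ w, ∀ A ∈ Ms w, l • 1 ≤ A ∧ ‖A‖ ≤ L) (hϱ₀ : 0 ≤ ϱ) (hϱ₁ : ϱ < 1) (hν : ν < 1)
    (hτ : 0 < τ) (hϖ₀ : 0 < ϖ) (hϖ₁ : ϖ ≤ 1) {w w' : E}
    (hstep : IsNewtonStep F G Ms ϱ ν τ ϖ w w') :
    ϱ * (ϖ * ((1 - ϱ) * (l / L))) * (‖G w‖ ^ 2 / (2 * L)) ≤ F w - F w' := by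
  obtain ⟨A, hA, h, ⟨k, hk⟩, hres, ι, hι, rfl⟩ := hstep
  have hL : 0 < L := hl.trans_le hlL
  have descent := half_sq_norm_add_le_neg_inner hl (hM w A hA).1 (hM w A hA).2 hν hτ hk hres
  have hh : 0 ≤ l / 2 * ‖h‖ ^ 2 := by positivity
  have hg : 0 ≤ ‖G w‖ ^ 2 / (2 * L) := by positivity
  have stepLength := H.le_armijo_stepLength hl hlL hϱ₀ hϱ₁ hϖ₀ hϖ₁ (by linarith) hι
  have armijo : F (w + ϖ ^ ι • h) ≤ F w + ϱ * ϖ ^ ι * ⟪G w, h⟫_ℝ := hι.1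
  calc ϱ * (ϖ * ((1 - ϱ) * (l / L))) * (‖G w‖ ^ 2 / (2 * L))
      ≤ ϱ * ϖ ^ ι * (‖G w‖ ^ 2 / (2 * L)) := by gcongr
    _ ≤ ϱ * ϖ ^ ι * -⟪G w, h⟫_ℝ := by gcongr; linarith
    _ ≤ F w - F (w + ϖ ^ ι • h) := by linarith

lemma tendsto_zero_of_sufficient_decrease (H : HasQuadraticBounds l L F G) (hl : 0 < l) {c : ℝ}
    (hc : 0 < c) {w : ℕ → E} (hdec : ∀ j, c * ‖G (w j)‖ ^ 2 ≤ F (w j) - F (w (j + 1))) :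
    Tendsto (fun j => G (w j)) atTop (𝓝 0) := by
  have hanti : Antitone fun j => F (w j) := antitone_nat_of_succ_le fun j => by
    have : 0 ≤ c * ‖G (w j)‖ ^ 2 := by positivity
    linarith [hdec j]
  have hbdd : BddBelow (Set.range fun j => F (w j)) :=
    ⟨F 0 - ‖G 0‖ ^ 2 / (2 * l), by rintro _ ⟨j, rfl⟩; exact H.sub_le hl 0 (w j)⟩
  have hlim := tendsto_atTop_ciInf hanti hbdd
  have hdiff : Tendsto (fun j => (F (w j) - F (w (j + 1))) / c) atTop (𝓝 0) := by
    simpa using (hlim.sub (hlim.comp (tendsto_add_atTop_nat 1))).div_const c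
  have hsq : Tendsto (fun j => ‖G (w j)‖ ^ 2) atTop (𝓝 0) :=
    squeeze_zero (fun j => sq_nonneg _) (fun j => (le_div_iff₀' hc).2 (hdec j)) hdiff
  exact tendsto_zero_iff_norm_tendsto_zero.2 (by simpa [Real.sqrt_sq] using hsq.sqrt)

/-- The gradient of a strongly convex function is a closed embedding, so that no minimizer has to
be produced beforehand. -/
lemma exists_tendsto_of_tendsto_zero [CompleteSpace E] (H : HasQuadraticBounds l L F G)
    (hl : 0 < l) (hL : 0 < L) {w : ℕ → E} (hw : Tendsto (fun j => G (w j)) atTop (𝓝 0)) :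
    ∃ x, G x = 0 ∧ Tendsto w atTop (𝓝 x) := by
  have hG : IsClosedEmbedding G :=
    (H.antilipschitzWith hl).isClosedEmbedding (H.lipschitzWith hl.le hL).uniformContinuous
  obtain ⟨x, hx⟩ : (0 : E) ∈ Set.range G :=
    hG.isClosed_range.mem_of_tendsto hw (Eventually.of_forall fun j => Set.mem_range_self _)
  exact ⟨x, hx, hG.isEmbedding.tendsto_nhds_iff.2 (by rwa [hx])⟩

theorem exists_tendsto_newton [CompleteSpace E] (H : HasQuadraticBounds l L F G) (hl : 0 < l)
    (hlL : l ≤ L) (hM : ∀ w, ∀ A ∈ Ms w, l • 1 ≤ A ∧ ‖A‖ ≤ L) (hϱ₀ : 0 < ϱ) (hϱ₁ : ϱ < 1)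
    (hν : ν < 1) (hτ : 0 < τ) (hϖ₀ : 0 < ϖ) (hϖ₁ : ϖ ≤ 1) {w : ℕ → E}
    (hstep : ∀ j, IsNewtonStep F G Ms ϱ ν τ ϖ (w j) (w (j + 1))) :
    ∃ x, G x = 0 ∧ Tendsto w atTop (𝓝 x) := by
  have hL : 0 < L := hl.trans_le hlL
  have : 0 < 1 - ϱ := sub_pos.2 hϱ₁
  refine H.exists_tendsto_of_tendsto_zero hl hL (H.tendsto_zero_of_sufficient_decrease hl
    (c := ϱ * (ϖ * ((1 - ϱ) * (l / L))) / (2 * L)) (by positivity) fun j => ?_)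
  rw [div_mul_eq_mul_div, ← mul_div_assoc']
  exact H.sufficient_decrease hl hlL hM hϱ₀.le hϱ₁ hν hτ hϖ₀ hϖ₁ (hstep j)

/-- The full step `h` is accepted as soon as it reduces the distance to the critical point `x` by a
sufficiently small factor `δ`: the linear expansion makes the predicted decrease
`(1 / 2 - ϱ) * ⟪w - x, A (w - x)⟫`, and the error caused by `w + h ≠ x` is of order `δ`. -/
lemma armijo_fullStep (H : HasQuadraticBounds l L F G) (hϱ₀ : 0 ≤ ϱ) (hϱ₁ : ϱ ≤ 1 / 2)
    (hL : 0 ≤ L) {A : E →L[ℝ] E} (hA : l • 1 ≤ A) (hAL : ‖A‖ ≤ L) {x w h : E} (hx : G x = 0)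
    (hexp : HasExactExpansion F G A x w) {δ : ℝ} (hδ : ‖w + h - x‖ ≤ δ * ‖w - x‖)
    (hsmall : ϱ * L * δ + L / 2 * δ ^ 2 ≤ (1 / 2 - ϱ) * l) :
    F (w + h) ≤ F w + ϱ * ⟪G w, h⟫_ℝ := by
  have value := hexp.map_eq
  have slope := hexp.grad_eq
  have model := H.upper x (w + h)
  rw [hx, inner_zero_left, add_zero] at value model
  rw [hx, zero_add] at slope
  set e := w - x with he
  set s := w + h - x with hs
  have predicted : ⟪G w, h⟫_ℝ = ⟪A e, s⟫_ℝ - ⟪e, A e⟫_ℝ := by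
    rw [slope, show h = s - e by rw [hs, he]; abel, inner_sub_right, real_inner_comm e (A e)]
  have mixed : -(L * δ * ‖e‖ ^ 2) ≤ ⟪A e, s⟫_ℝ := by
    refine neg_le_of_abs_le ((abs_real_inner_le_norm _ _).trans ?_)
    calc ‖A e‖ * ‖s‖ ≤ (L * ‖e‖) * (δ * ‖e‖) := by gcongr; exact A.le_of_opNorm_le hAL e
      _ = L * δ * ‖e‖ ^ 2 := by ring
  have quadratic : L / 2 * ‖s‖ ^ 2 ≤ L / 2 * δ ^ 2 * ‖e‖ ^ 2 := by
    rw [mul_assoc, ← mul_pow]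
    gcongr
  have coercive := mul_le_mul_of_nonneg_left (mul_sq_norm_le_inner_of_smul_one_le hA e)
    (sub_nonneg.2 hϱ₁)
  have small := mul_le_mul_of_nonneg_right hsmall (sq_nonneg ‖e‖)
  rw [predicted]
  linarith [mul_le_mul_of_nonneg_left mixed hϱ₀]

end HasQuadraticBounds

/-- The Newton step inherits its order from the accuracy test, since `A (w + h - x) = A h + G w`. -/
lemma HasExactExpansion.norm_newton_le {F : E → ℝ} {G : E → E} {A : E →L[ℝ] E} {l L r : ℝ}
    {x w h : E} (hexp : HasExactExpansion F G A x w) (hx : G x = 0) (hl : 0 < l) (hA : l • 1 ≤ A)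
    (hAL : ‖A‖ ≤ L) (hr : 0 ≤ r) (hres : ‖A h + G w‖ ≤ ‖G w‖ ^ r) :
    ‖w + h - x‖ ≤ L ^ r / l * ‖w - x‖ ^ r := by
  have slope : G w = A (w - x) := by rw [hexp.grad_eq, hx, zero_add]
  have residual : A (w + h - x) = A h + G w := by rw [slope, ← map_add]; congr 1; abel
  rw [div_mul_eq_mul_div, le_div_iff₀' hl]
  calc l * ‖w + h - x‖ ≤ ‖A (w + h - x)‖ := mul_norm_le_norm_of_mul_sq_norm_le_inner
        (mul_sq_norm_le_inner_of_smul_one_le hA _)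
    _ ≤ ‖G w‖ ^ r := residual ▸ hres
    _ ≤ (L * ‖w - x‖) ^ r := by
        gcongr
        exact slope ▸ A.le_of_opNorm_le hAL _
    _ = L ^ r * ‖w - x‖ ^ r := Real.mul_rpow ((norm_nonneg A).trans hAL) (norm_nonneg _)

namespace HasQuadraticBounds

variable {F : E → ℝ} {G : E → E} {l L ϱ ν τ ϖ : ℝ} {Ms : E → Set (E →L[ℝ] E)}

lemma eventually_norm_newton_le (H : HasQuadraticBounds l L F G) (hl : 0 < l) (hL : 0 ≤ L)
    (hM : ∀ w, ∀ A ∈ Ms w, l • 1 ≤ A ∧ ‖A‖ ≤ L) {x : E} (hx : G x = 0)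
    (hexp : ∀ᶠ w in 𝓝 x, ∀ A ∈ Ms w, HasExactExpansion F G A x w) (hϱ₀ : 0 ≤ ϱ)
    (hϱ₁ : ϱ < 1 / 2) (hτ : 0 < τ) :
    ∀ᶠ w in 𝓝 x, ∀ w', IsNewtonStep F G Ms ϱ ν τ ϖ w w' →
      ‖w' - x‖ ≤ L ^ (1 + τ) / l * ‖w - x‖ ^ (1 + τ) := by
  have hδ : Tendsto (fun w => L ^ (1 + τ) / l * ‖w - x‖ ^ τ) (𝓝 x) (𝓝 0) := by
    have hcont : Continuous fun w => L ^ (1 + τ) / l * ‖w - x‖ ^ τ :=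
      continuous_const.mul ((continuous_id.sub continuous_const).norm.rpow_const
        fun _ => Or.inr hτ.le)
    simpa [Real.zero_rpow hτ.ne'] using hcont.tendsto x
  have hsmall := ((hδ.const_mul (ϱ * L)).add ((hδ.pow 2).const_mul (L / 2))).eventually_le_const
    (u := (1 / 2 - ϱ) * l) (by simpa using mul_pos (sub_pos.2 hϱ₁) hl)
  filter_upwards [hexp, hsmall] with w hexp_w hsmall_w w' hstep
  obtain ⟨A, hA, h, -, hres, ι, hι, rfl⟩ := hstep
  obtain ⟨hAl, hAL⟩ := hM w A hA
  have contraction := (hexp_w A hA).norm_newton_le hx hl hAl hAL (by linarith)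
    (hres.trans (min_le_right _ _))
  have accepted := H.armijo_fullStep (h := h) hϱ₀ hϱ₁.le hL hAl hAL hx (hexp_w A hA)
    (contraction.trans_eq (by
      rw [add_comm, Real.rpow_add_one' (norm_nonneg _) (by linarith), mul_assoc])) hsmall_w
  have hι₀ : ι = 0 := Nat.le_zero.1 (hι.2 (by simpa [armijoExponents] using accepted))
  simpa [hι₀] using contraction

theorem newton_convergence [CompleteSpace E] (H : HasQuadraticBounds l L F G) (hl : 0 < l)
    (hlL : l ≤ L) (hM : ∀ w, ∀ A ∈ Ms w, l • 1 ≤ A ∧ ‖A‖ ≤ L)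
    (hexp : ∀ x, ∀ᶠ w in 𝓝 x, ∀ A ∈ Ms w, HasExactExpansion F G A x w) (hϱ₀ : 0 < ϱ)
    (hϱ₁ : ϱ < 1 / 2) (hν : ν < 1) (hτ : 0 < τ) (hϖ₀ : 0 < ϖ) (hϖ₁ : ϖ ≤ 1) {w : ℕ → E}
    (hstep : ∀ j, IsNewtonStep F G Ms ϱ ν τ ϖ (w j) (w (j + 1))) :
    ∃ x, (∀ v, F x ≤ F v) ∧ (∀ v, (∀ v', F v ≤ F v') → v = x) ∧ Tendsto w atTop (𝓝 x) ∧
      (fun j => ‖w (j + 1) - x‖) =O[atTop] (fun j => ‖w j - x‖ ^ (1 + τ)) ∧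
      (fun j => ‖w (j + 1) - x‖) =o[atTop] (fun j => ‖w j - x‖) ∧
      (τ = 1 → (fun j => ‖w (j + 1) - x‖) =O[atTop] (fun j => ‖w j - x‖ ^ 2)) := by
  obtain ⟨x, hx, hlim⟩ :=
    H.exists_tendsto_newton hl hlL hM hϱ₀ (by linarith) hν hτ hϖ₀ hϖ₁ hstep
  have rate : (fun j => ‖w (j + 1) - x‖) =O[atTop] (fun j => ‖w j - x‖ ^ (1 + τ)) := by
    refine IsBigO.of_bound (L ^ (1 + τ) / l) ?_
    filter_upwards [hlim.eventually (H.eventually_norm_newton_le (ν := ν) (ϖ := ϖ) hl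
      (hl.le.trans hlL) hM hx (hexp x) hϱ₀.le hϱ₁ hτ)] with j hj
    rw [norm_norm, Real.norm_of_nonneg (by positivity)]
    exact hj _ (hstep j)
  refine ⟨x, H.le_of_eq_zero hl.le hx,
    fun v hv => H.eq_of_eq_zero hl hx (H.eq_zero_of_forall_le hv), hlim, rate,
    rate.trans_isLittleO (isLittleO_rpow_one_add (fun _ => norm_nonneg _) hτ
      (tendsto_iff_norm_sub_tendsto_zero.1 hlim)), ?_⟩
  rintro rfl
  simpa only [one_add_one_eq_two, Real.rpow_two] using rate

end HasQuadraticBounds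

end NewtonMethod

/-! ### Metric projections and the envelope of an indicator function -/

section Projection

variable {E : Type} [NormedAddCommGroup E] {C : Set E} {q p : E}

lemma IsProjection.moreauIndicator_eq (h : IsProjection C q p) :
    moreauIndicator C q = 1 / 2 * ‖q - p‖ ^ 2 := by
  have hne : Nonempty C := ⟨⟨p, h.1⟩⟩
  rw [norm_sub_rev]
  refine le_antisymm (ciInf_le ⟨0, by rintro _ ⟨y, rfl⟩; positivity⟩ (⟨p, h.1⟩ : C)) ?_
  refine le_ciInf fun z => ?_
  gcongr
  exact h.2 z z.2

lemma moreauIndicator_le {z : E} (hz : z ∈ C) : moreauIndicator C q ≤ 1 / 2 * ‖q - z‖ ^ 2 := by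
  rw [norm_sub_rev]
  exact ciInf_le ⟨0, by rintro _ ⟨y, rfl⟩; positivity⟩ (⟨z, hz⟩ : C)

variable [InnerProductSpace ℝ E]

lemma norm_sub_sq_eq_of_base (q p z : E) :
    ‖z - q‖ ^ 2 = ‖z - p‖ ^ 2 - 2 * ⟪q - p, z - p⟫_ℝ + ‖p - q‖ ^ 2 := by
  rw [norm_sub_rev p q, ← sub_sub_sub_cancel_right z q p, norm_sub_sq_real, real_inner_comm]

lemma IsProjection.of_inner_le (hp : p ∈ C) (h : ∀ z ∈ C, ⟪q - p, z - p⟫_ℝ ≤ 0) :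
    IsProjection C q p := by
  refine ⟨hp, fun z hz => le_of_sq_le_sq ?_ (norm_nonneg _)⟩
  linarith [norm_sub_sq_eq_of_base q p z, h z hz, sq_nonneg ‖z - p‖]

lemma IsProjection.inner_le (hC : Convex ℝ C) (h : IsProjection C q p) {z : E} (hz : z ∈ C) :
    ⟪q - p, z - p⟫_ℝ ≤ 0 := by
  have hne : Nonempty C := ⟨⟨p, h.1⟩⟩
  refine (norm_eq_iInf_iff_real_inner_le_zero hC h.1).1 (le_antisymm ?_ ?_) z hz
  · refine le_ciInf fun y => ?_
    rw [norm_sub_rev q p, norm_sub_rev q]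
    exact h.2 y y.2
  · exact ciInf_le ⟨0, by rintro _ ⟨y, rfl⟩; exact norm_nonneg _⟩ (⟨p, h.1⟩ : C)

lemma IsProjection.eq_of_norm_sub_le (hC : Convex ℝ C) (h : IsProjection C q p) {z : E}
    (hz : z ∈ C) (hle : ‖z - q‖ ≤ ‖p - q‖) : z = p := by
  have hsq : ‖z - q‖ ^ 2 ≤ ‖p - q‖ ^ 2 := by gcongr
  have hdist : ‖z - p‖ ^ 2 ≤ 0 := by linarith [norm_sub_sq_eq_of_base q p z, h.inner_le hC hz]
  simpa [sub_eq_zero] using hdist.antisymm (sq_nonneg _)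

lemma exists_isProjection (hne : C.Nonempty) (hcomp : IsComplete C) (hC : Convex ℝ C) (q : E) :
    ∃ p, IsProjection C q p := by
  obtain ⟨p, hp, h⟩ := exists_norm_eq_iInf_of_complete_convex hne hcomp hC q
  exact ⟨p, .of_inner_le hp ((norm_eq_iInf_iff_real_inner_le_zero hC hp).1 h)⟩

theorem hasQuadraticBounds_moreauIndicator (hC : Convex ℝ C) {π : E → E}
    (hπ : ∀ q, IsProjection C q (π q)) :
    HasQuadraticBounds 0 1 (moreauIndicator C) (fun q => q - π q) where
  lower q v := by
    have hsub := norm_add_sq_real (q - π q) (v - π v - (q - π q))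
    have hnonneg := sq_nonneg ‖v - π v - (q - π q)‖
    have hinner := (hπ q).inner_le hC (hπ v).1
    rw [add_sub_cancel, sub_sub_sub_comm, inner_sub_right] at hsub
    rw [sub_sub_sub_comm] at hnonneg
    rw [(hπ q).moreauIndicator_eq, (hπ v).moreauIndicator_eq]
    linarith
  upper q v := by
    have hsq := norm_add_sq_real (q - π q) (v - q)
    rw [sub_add_sub_cancel'] at hsq
    rw [(hπ q).moreauIndicator_eq]
    linarith [moreauIndicator_le (q := v) (hπ q).1]

theorem hasExactExpansion_moreauIndicator [CompleteSpace E] {N : E →L[ℝ] E}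
    (hN : IsStarProjection N) {π : E → E} (hπ : ∀ q, IsProjection C q (π q)) {x w : E}
    (hsub : π w - π x = N (w - x)) (hres : N (x - π x) = 0) :
    HasExactExpansion (moreauIndicator C) (fun q => q - π q) (1 - N) x w := by
  have hgrad : w - π w = x - π x + (1 - N) (w - x) := by
    rw [sub_apply, one_apply_eq_self, ← hsub]
    abel
  have hcross : ⟪x - π x, (1 - N) (w - x)⟫_ℝ = ⟪x - π x, w - x⟫_ℝ := by
    have hsymm := ContinuousLinearMap.adjoint_inner_left N (w - x) (x - π x)
    rw [hN.isSelfAdjoint.adjoint_eq, hres, inner_zero_left] at hsymm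
    rw [sub_apply, one_apply_eq_self, inner_sub_right, ← hsymm, sub_zero]
  have hproj : ‖(1 - N) (w - x)‖ ^ 2 = ⟪w - x, (1 - N) (w - x)⟫_ℝ := by
    rw [← real_inner_self_eq_norm_sq, ← ContinuousLinearMap.adjoint_inner_right,
      hN.one_sub.isSelfAdjoint.adjoint_eq, ← mul_apply_eq_comp,
      hN.one_sub.isIdempotentElem.eq]
  refine ⟨?_, hgrad⟩
  rw [(hπ w).moreauIndicator_eq, (hπ x).moreauIndicator_eq, hgrad, norm_add_sq_real, hcross, hproj]
  ring

end Projection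

/-! ### Projections onto polyhedra -/

section AffineProjection

variable {ι κ : Type*} [Fintype ι] [DecidableEq ι] [Fintype κ]

lemma isUnit_det_mul_transpose_self {A : Matrix ι κ ℝ} (hA : LinearIndependent ℝ A.row) :
    IsUnit (A * Aᵀ).det := by
  rw [← Matrix.isUnit_iff_isUnit_det, ← Matrix.conjTranspose_eq_transpose_of_trivial]
  exact (Matrix.PosDef.mul_conjTranspose_self A (Matrix.vecMul_injective_iff.2 hA)).isUnit

/-- The Lagrange multiplier of the orthogonal projection of `q` onto the affine subspace
`{w | A w = c}`; meaningful only if the rows of `A` are linearly independent. -/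
def affineMultiplier (A : Matrix ι κ ℝ) (c : ι → ℝ) (q : EuclideanSpace ℝ κ) : ι → ℝ :=
  (A * Aᵀ)⁻¹ *ᵥ (A *ᵥ q.ofLp - c)

/-- The orthogonal projection of `q` onto the affine subspace `{w | A w = c}`; meaningful only if
the rows of `A` are linearly independent. -/
def affineProjection (A : Matrix ι κ ℝ) (c : ι → ℝ) (q : EuclideanSpace ℝ κ) :
    EuclideanSpace ℝ κ :=
  WithLp.toLp 2 (q.ofLp - Aᵀ *ᵥ affineMultiplier A c q)

/-- The orthogonal projector `I - Aᵀ (A Aᵀ)⁻¹ A` onto the kernel of `A`; meaningful only if the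
rows of `A` are linearly independent. -/
def kerProjection [DecidableEq κ] (A : Matrix ι κ ℝ) : Matrix κ κ ℝ :=
  1 - Aᵀ * (A * Aᵀ)⁻¹ * A

variable {A : Matrix ι κ ℝ} {c : ι → ℝ}

lemma continuous_affineMultiplier : Continuous (affineMultiplier A c) := by
  unfold affineMultiplier
  fun_prop

lemma continuous_affineProjection : Continuous (affineProjection A c) := by
  have := continuous_affineMultiplier (A := A) (c := c)
  unfold affineProjection
  fun_prop

lemma ofLp_sub_affineProjection (q : EuclideanSpace ℝ κ) :
    (q - affineProjection A c q).ofLp = Aᵀ *ᵥ affineMultiplier A c q := by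
  simp [affineProjection]

lemma mulVec_affineProjection (hA : LinearIndependent ℝ A.row) (q : EuclideanSpace ℝ κ) :
    A *ᵥ (affineProjection A c q).ofLp = c := by
  rw [affineProjection, affineMultiplier, Matrix.mulVec_sub, Matrix.mulVec_mulVec,
    Matrix.mulVec_mulVec, Matrix.mul_nonsing_inv _ (isUnit_det_mul_transpose_self hA),
    Matrix.one_mulVec, sub_sub_cancel]

lemma affineMultiplier_eq (hA : LinearIndependent ℝ A.row) {q p : EuclideanSpace ℝ κ} {μ : ι → ℝ}
    (hstat : p.ofLp = q.ofLp - Aᵀ *ᵥ μ) (hp : A *ᵥ p.ofLp = c) : affineMultiplier A c q = μ := by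
  have gram_mulVec : A *ᵥ q.ofLp - c = (A * Aᵀ) *ᵥ μ := by
    rw [← hp, hstat, Matrix.mulVec_sub, sub_sub_cancel, Matrix.mulVec_mulVec]
  rw [affineMultiplier, gram_mulVec, Matrix.mulVec_mulVec,
    Matrix.nonsing_inv_mul _ (isUnit_det_mul_transpose_self hA), Matrix.one_mulVec]

variable [DecidableEq κ]

lemma kerProjection_mul_transpose (hA : LinearIndependent ℝ A.row) : kerProjection A * Aᵀ = 0 := by
  rw [kerProjection, Matrix.sub_mul, Matrix.one_mul, Matrix.mul_assoc, Matrix.mul_assoc,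
    Matrix.nonsing_inv_mul _ (isUnit_det_mul_transpose_self hA), Matrix.mul_one, sub_self]

lemma isStarProjection_kerProjection (hA : LinearIndependent ℝ A.row) :
    IsStarProjection (kerProjection A) where
  isIdempotentElem := by
    rw [IsIdempotentElem]
    nth_rw 2 [kerProjection]
    rw [mul_sub, mul_one, Matrix.mul_assoc Aᵀ, ← Matrix.mul_assoc _ Aᵀ,
      kerProjection_mul_transpose hA, Matrix.zero_mul, sub_zero]
  isSelfAdjoint := by
    rw [IsSelfAdjoint, Matrix.star_eq_conjTranspose, Matrix.conjTranspose_eq_transpose_of_trivial]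
    simp [kerProjection, Matrix.transpose_nonsing_inv, Matrix.mul_assoc]

lemma kerProjection_sub_affineProjection (hA : LinearIndependent ℝ A.row)
    (q : EuclideanSpace ℝ κ) :
    Matrix.toEuclideanCLM (𝕜 := ℝ) (kerProjection A) (q - affineProjection A c q) = 0 := by
  apply WithLp.ofLp_injective 2
  rw [Matrix.ofLp_toEuclideanCLM, ofLp_sub_affineProjection, Matrix.mulVec_mulVec,
    kerProjection_mul_transpose hA, Matrix.zero_mulVec, WithLp.ofLp_zero]

lemma affineProjection_sub_affineProjection (q q' : EuclideanSpace ℝ κ) :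
    affineProjection A c q - affineProjection A c q' =
      Matrix.toEuclideanCLM (𝕜 := ℝ) (kerProjection A) (q - q') := by
  apply WithLp.ofLp_injective 2
  simp only [affineProjection, affineMultiplier, kerProjection, Matrix.ofLp_toEuclideanCLM,
    WithLp.ofLp_sub, Matrix.sub_mulVec, Matrix.one_mulVec, Matrix.mulVec_sub,
    ← Matrix.mulVec_mulVec]
  abel

end AffineProjection

section Polyhedron

lemma eventually_mem_imp_of_isClosed {X : Type*} [TopologicalSpace X] {F : Set X}
    (hF : IsClosed F) (x : X) : ∀ᶠ w in 𝓝 x, w ∈ F → x ∈ F := by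
  by_cases hx : x ∈ F
  · exact .of_forall fun _ _ => hx
  · exact (hF.isOpen_compl.eventually_mem hx).mono fun _ hw hwF => absurd hwF hw

lemma transpose_mulVec_eq_rowSub {ρ κ : Type} [Fintype ρ] {B : Matrix ρ κ ℝ}
    {K : Finset ρ} {μ : ρ → ℝ} (hμ : ∀ r, μ r ≠ 0 → r ∈ K) :
    Bᵀ *ᵥ μ = (rowSub B K)ᵀ *ᵥ fun r : K => μ r := by
  ext k
  simp only [Matrix.mulVec, dotProduct, Matrix.transpose_apply, rowSub, Matrix.submatrix_apply, id]
  rw [Finset.sum_coe_sort K (fun r => B r k * μ r)]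
  refine (Finset.sum_subset (Finset.subset_univ _) fun r _ hr => ?_).symm
  rw [not_imp_comm.1 (hμ r) hr, mul_zero]

variable {ρ κ : Type} [Fintype κ] {B : Matrix ρ κ ℝ} {c : ρ → ℝ} {K : Finset ρ}

lemma convex_polyhedron : Convex ℝ (polyhedron B c) := by
  rw [polyhedron, Set.ofPred_forall]
  refine convex_iInter fun r => ?_
  exact convex_halfSpace_le (f := fun w : EuclideanSpace ℝ κ => (B *ᵥ w.ofLp) r)
    ⟨fun x y => by simp [Matrix.mulVec_add], fun a x => by simp [Matrix.mulVec_smul]⟩ _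

lemma isClosed_polyhedron : IsClosed (polyhedron B c) := by
  rw [polyhedron, Set.ofPred_forall]
  exact isClosed_iInter fun r => isClosed_le (by fun_prop) continuous_const

variable [DecidableEq ρ]

/-- The points whose projection onto the affine subspace `{w | B_K w = c_K}` lies in the polyhedron
`{w | B w ≤ c}` and has nonnegative multipliers, so that it is the projection onto the
polyhedron. -/
def faceRegion (B : Matrix ρ κ ℝ) (c : ρ → ℝ) (K : Finset ρ) : Set (EuclideanSpace ℝ κ) :=
  {q | 0 ≤ affineMultiplier (rowSub B K) (fun r => c r) q ∧
    affineProjection (rowSub B K) (fun r => c r) q ∈ polyhedron B c}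

lemma isClosed_faceRegion : IsClosed (faceRegion B c K) :=
  (isClosed_Ici.preimage continuous_affineMultiplier).inter
    (isClosed_polyhedron.preimage continuous_affineProjection)

lemma isProjection_affineProjection (hK : LinearIndependent ℝ (rowSub B K).row)
    {q : EuclideanSpace ℝ κ} (hq : q ∈ faceRegion B c K) :
    IsProjection (polyhedron B c) q (affineProjection (rowSub B K) (fun r => c r) q) := by
  refine .of_inner_le hq.2 fun z hz => ?_
  rw [EuclideanSpace.inner_eq_star_dotProduct, star_trivial, dotProduct_comm,
    ofLp_sub_affineProjection, Matrix.mulVec_transpose, ← Matrix.dotProduct_mulVec,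
    WithLp.ofLp_sub, Matrix.mulVec_sub, mulVec_affineProjection hK]
  exact Finset.sum_nonpos fun r _ => mul_nonpos_of_nonneg_of_nonpos (hq.1 r) (sub_nonpos.2 (hz r))

variable [Fintype ρ]

lemma mem_faceRegion_of_isMultiplier (hK : LinearIndependent ℝ (rowSub B K).row)
    {q p : EuclideanSpace ℝ κ} {μ : ρ → ℝ} (hμ : IsMultiplier B c q p μ)
    (hsupp : ∀ r, μ r ≠ 0 → r ∈ K) (hact : ∀ r ∈ K, (B *ᵥ p.ofLp) r = c r) :
    q ∈ faceRegion B c K ∧ affineProjection (rowSub B K) (fun r => c r) q = p := by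
  obtain ⟨hμ_nonneg, hstat, hfeas, -⟩ := hμ
  have hp : p.ofLp = q.ofLp - (rowSub B K)ᵀ *ᵥ fun r : K => μ r := by
    rw [← transpose_mulVec_eq_rowSub hsupp]
    exact eq_sub_of_add_eq (sub_eq_zero.1 (by rw [← hstat]; abel))
  have hmult := affineMultiplier_eq hK hp (funext fun r : K => hact r r.2)
  have hproj : affineProjection (rowSub B K) (fun r => c r) q = p := by
    rw [affineProjection, hmult, ← hp]
  refine ⟨⟨?_, ?_⟩, hproj⟩
  · rw [hmult]
    exact fun r => hμ_nonneg r
  · rw [hproj]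
    exact fun r => sub_nonpos.1 (hfeas r)

variable [DecidableEq κ]

lemma isStarProjection_of_mem_hsJacobian {q : EuclideanSpace ℝ κ} {N : Matrix κ κ ℝ}
    (hN : N ∈ hsJacobian B c q) : IsStarProjection (Matrix.toEuclideanCLM (𝕜 := ℝ) N) := by
  obtain ⟨p, μ, K, -, -, -, -, hK, rfl⟩ := hN
  exact (isStarProjection_kerProjection hK).map Matrix.toEuclideanCLM

-- The regions of the finitely many faces are closed, so near `x` only those containing `x` occur.
theorem eventually_hsJacobian_linearizes {S : Set (Matrix ρ κ ℝ)} (hS : S.Finite) (c : ρ → ℝ)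
    (x : EuclideanSpace ℝ κ) :
    ∀ᶠ w in 𝓝 x, ∀ B ∈ S, ∀ N ∈ hsJacobian B c w, ∃ p p', IsProjection (polyhedron B c) w p ∧
      IsProjection (polyhedron B c) x p' ∧ p - p' = Matrix.toEuclideanCLM (𝕜 := ℝ) N (w - x) ∧
      Matrix.toEuclideanCLM (𝕜 := ℝ) N (x - p') = 0 := by
  have hregion : ∀ᶠ w in 𝓝 x, ∀ B ∈ S, ∀ K : Finset ρ,
      w ∈ faceRegion B c K → x ∈ faceRegion B c K := by
    rw [hS.eventually_all]
    exact fun B _ => eventually_all.2 fun K => eventually_mem_imp_of_isClosed isClosed_faceRegion x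
  filter_upwards [hregion] with w hw B hB N hN
  obtain ⟨p, μ, K, hp, hμ, hsupp, hact, hK, rfl⟩ := hN
  obtain ⟨hwK, hwp⟩ := mem_faceRegion_of_isMultiplier hK hμ hsupp hact
  refine ⟨p, _, hp, isProjection_affineProjection hK (hw B hB K hwK), ?_,
    kerProjection_sub_affineProjection hK x⟩
  rw [← hwp]
  exact affineProjection_sub_affineProjection w x

end Polyhedron

/-! ### Clipping and sign patterns -/

section Clip

variable {t x y z : ℝ}

/-- The point of `[-t, t]` nearest to `x`, for `0 ≤ t`. -/
def clip (t x : ℝ) : ℝ := max (-t) (min t x)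

lemma clip_zero_right (ht : 0 ≤ t) : clip t 0 = 0 := by
  rw [clip, min_eq_right ht, max_eq_right (neg_nonpos.2 ht)]

lemma abs_clip_le (ht : 0 ≤ t) : |clip t x| ≤ t :=
  abs_le.2 ⟨le_max_left _ _, max_le (by linarith) (min_le_left _ _)⟩

lemma abs_clip_sub_le (hz : |z| ≤ t) : |clip t x - x| ≤ |z - x| := by
  obtain ⟨hz₁, hz₂⟩ := abs_le.1 hz
  grind [clip]

lemma sign_mul_clip (h : Real.sign y * x = |x|) (ht : 0 ≤ t) :
    Real.sign y * clip t x = min |x| t := by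
  rcases Real.sign_apply_eq y with hy | hy | hy <;> rw [hy] at h ⊢ <;> grind [clip]

lemma sign_mul_self_eq_abs (x : ℝ) : Real.sign x * x = |x| := by
  rcases lt_trichotomy x 0 with h | rfl | h
  · simp [Real.sign_of_neg h, abs_of_neg h]
  · simp
  · simp [Real.sign_of_pos h, abs_of_pos h]

lemma abs_eq_sign_mul (hy : y ≠ 0) (h : 0 ≤ Real.sign y * z) : |z| = Real.sign y * z := by
  rcases Real.sign_apply_eq_of_ne_zero y hy with hs | hs <;> rw [hs] at h ⊢
  · rw [abs_of_nonpos (by linarith), neg_one_mul]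
  · rw [abs_of_nonneg (by linarith), one_mul]

lemma eventually_sign_mul_eq_abs (x : ℝ) : ∀ᶠ y in 𝓝 x, Real.sign y * x = |x| := by
  rcases lt_trichotomy x 0 with h | rfl | h
  · filter_upwards [gt_mem_nhds h] with y hy
    simp [Real.sign_of_neg hy, abs_of_neg h]
  · simp
  · filter_upwards [lt_mem_nhds h] with y hy
    simp [Real.sign_of_pos hy, abs_of_pos h]

end Clip

section LeadSign

variable {d n : ℕ}

lemma norm1inf_eq_sum_norm (W : Matrix (Fin d) (Fin n) ℝ) : norm1inf W = ∑ i, ‖W i‖ := by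
  refine Finset.sum_congr rfl fun i _ => le_antisymm ?_ ?_
  · exact Real.iSup_le (fun j => norm_le_pi_norm (W i) j) (norm_nonneg _)
  · refine (pi_norm_le_iff_of_nonneg (Real.iSup_nonneg fun j => abs_nonneg _)).2 fun j => ?_
    exact le_ciSup (f := fun j => |W i j|) (Set.finite_range _).bddAbove j

variable (Q Z : Matrix (Fin d) (Fin n) ℝ) (i : Fin d)

lemma sum_leadSign_mul_le {t : ℝ} (ht : 0 ≤ t) (h : ∀ l, Real.sign (Q i l) * Z i l ≤ t) :
    ∑ l, leadSign Q i l * Z i l ≤ t := by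
  rcases isEmpty_or_nonempty (Fin n) with hn | ⟨⟨j⟩⟩
  · simpa using ht
  · obtain ⟨a, -, hsum⟩ := PALSubproblem.leadSign_sum Q i j
    exact (hsum _).trans_le (h a)

lemma sum_leadSign_mul_nonneg (h : ∀ l, 0 ≤ Real.sign (Q i l) * Z i l) :
    0 ≤ ∑ l, leadSign Q i l * Z i l := by
  rcases isEmpty_or_nonempty (Fin n) with hn | ⟨⟨j⟩⟩
  · simp
  · obtain ⟨a, -, hsum⟩ := PALSubproblem.leadSign_sum Q i j
    exact (h a).trans_eq (hsum _).symm

/-- The possible entries of `leadSign Q` and of the matrices `F` and `E` belonging to `Q`. -/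
def signValues : Set ℝ := {-1, 0, 1}

lemma finite_signValues : signValues.Finite := by simp [signValues]

lemma zero_mem_signValues : 0 ∈ signValues := by simp [signValues]

lemma sign_mem_signValues (x : ℝ) : Real.sign x ∈ signValues := Real.sign_apply_eq x

lemma leadSign_mem_signValues (j : Fin n) : leadSign Q i j ∈ signValues := by
  rw [leadSign, Matrix.of_apply]
  split_ifs
  exacts [sign_mem_signValues _, zero_mem_signValues]

lemma matF_mem_signValues (p k : Fin d × Fin n) : matF Q p k ∈ signValues := by
  rw [matF, Matrix.diagonal_apply]
  split_ifs
  exacts [sign_mem_signValues _, zero_mem_signValues]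

lemma matE_mem_signValues (k : Fin d × Fin n) : matE Q i k ∈ signValues := by
  rw [matE, Matrix.of_apply]
  split_ifs
  exacts [leadSign_mem_signValues _ _ _, zero_mem_signValues]

lemma matB_mem_sub_signValues (r : RowIdx d n) (k : Fin d × Fin n) :
    matB Q r k ∈ signValues - signValues := by
  rcases r with p | p | _
  · exact ⟨0, zero_mem_signValues, _, matF_mem_signValues Q p k, zero_sub _⟩
  · exact Set.sub_mem_sub (matF_mem_signValues Q p k) (matE_mem_signValues Q p.1 k)
  · exact ⟨_, leadSign_mem_signValues Q k.1 k.2, 0, zero_mem_signValues, sub_zero _⟩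

end LeadSign

namespace PALSubproblem

variable {d n : ℕ} {m : Fin n → ℕ} (P : PALSubproblem d n m)

lemma extend_coe (z : P.Space) (k : P.I) : P.extend z k.1.1 k.1.2 = z k := by simp [extend]

/-- Row `i` of the extension by zero, as a linear map. -/
def extendRow (i : Fin d) : P.Space →ₗ[ℝ] (Fin n → ℝ) where
  toFun z := P.extend z i
  map_add' z z' := by
    ext j
    by_cases h : (i, j) ∈ P.I <;> simp [extend, h]
  map_smul' a z := by
    ext j
    by_cases h : (i, j) ∈ P.I <;> simp [extend, h]

lemma continuous_extendRow (i : Fin d) : Continuous (P.extendRow i) :=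
  (P.extendRow i).continuous_of_finiteDimensional

lemma continuous_extend_apply (i : Fin d) (j : Fin n) : Continuous fun z => P.extend z i j :=
  (continuous_apply j).comp (P.continuous_extendRow i)

lemma norm_sub_le_of_forall_abs_le {z z' q : P.Space} (h : ∀ k, |z' k - q k| ≤ |z k - q k|) :
    ‖z' - q‖ ≤ ‖z - q‖ := by
  rw [EuclideanSpace.norm_eq, EuclideanSpace.norm_eq]
  gcongr with k
  exact h k

/-- The `ℓ_{1,∞}`-ball `{z | ‖𝒬† z‖_{1,∞} ≤ γ}` in the reduced space. -/
def ball : Set P.Space := {z | norm1inf (P.extend z) ≤ P.γ}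

lemma mem_ball {z : P.Space} : z ∈ P.ball ↔ ∑ i, ‖P.extend z i‖ ≤ P.γ := by
  rw [← norm1inf_eq_sum_norm]
  rfl

lemma ball_nonempty : P.ball.Nonempty :=
  have extend_zero (i) : P.extend 0 i = 0 := (P.extendRow i).map_zero
  ⟨0, P.mem_ball.2 (by simpa only [extend_zero, norm_zero, Finset.sum_const_zero] using P.γ_pos.le)⟩

lemma isClosed_ball : IsClosed P.ball := by
  simp only [ball, norm1inf_eq_sum_norm]
  exact isClosed_le (continuous_finsetSum _ fun i _ => (P.continuous_extendRow i).norm)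
    continuous_const

lemma convex_ball : Convex ℝ P.ball := by
  let gauge : Seminorm ℝ P.Space :=
    ∑ i, (normSeminorm ℝ (Fin n → ℝ)).comp (P.extendRow i)
  have ball_eq : P.ball = gauge.closedBall 0 P.γ := by
    ext z
    rw [mem_ball, Seminorm.mem_closedBall_zero, sum_apply]
    rfl
  rw [ball_eq]
  exact gauge.convex_closedBall 0 P.γ

/-- The metric projector onto the `ℓ_{1,∞}`-ball. -/
def proj (q : P.Space) : P.Space :=
  (exists_isProjection P.ball_nonempty P.isClosed_ball.isComplete P.convex_ball q).choose

lemma isProjection_proj (q : P.Space) : IsProjection P.ball q (P.proj q) :=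
  (exists_isProjection P.ball_nonempty P.isClosed_ball.isComplete P.convex_ball q).choose_spec

/-- The point whose entries are those of `q`, clipped to `[-θ i, θ i]` in row `i`. -/
def clipRows (θ : Fin d → ℝ) (q : P.Space) : P.Space :=
  WithLp.toLp 2 fun k => clip (θ k.1.1) (q k)

/-- The point whose entries are those of `z` where `q` is nonzero, and zero elsewhere. -/
def eraseZeros (q z : P.Space) : P.Space :=
  WithLp.toLp 2 fun k => if q k = 0 then 0 else z k

lemma extend_clipRows {θ : Fin d → ℝ} (hθ : 0 ≤ θ) (q : P.Space) (i : Fin d) (j : Fin n) :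
    P.extend (P.clipRows θ q) i j = clip (θ i) (P.extend q i j) := by
  by_cases h : (i, j) ∈ P.I <;> simp [extend, h, clipRows, clip_zero_right (hθ i)]

lemma extend_eraseZeros (q z : P.Space) (i : Fin d) (j : Fin n) :
    P.extend (P.eraseZeros q z) i j = if P.extend q i j = 0 then 0 else P.extend z i j := by
  by_cases h : (i, j) ∈ P.I <;> simp [extend, h, eraseZeros]

lemma clipRows_mem_ball {θ : Fin d → ℝ} (hθ : 0 ≤ θ) (hγ : ∑ i, θ i ≤ P.γ) (q : P.Space) :
    P.clipRows θ q ∈ P.ball := by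
  refine P.mem_ball.2 ((Finset.sum_le_sum fun i _ => ?_).trans hγ)
  refine (pi_norm_le_iff_of_nonneg (hθ i)).2 fun j => ?_
  rw [P.extend_clipRows hθ]
  exact abs_clip_le (hθ i)

lemma norm_clipRows_sub_le (q z : P.Space) :
    ‖P.clipRows (fun i => ‖P.extend z i‖) q - q‖ ≤ ‖z - q‖ := by
  refine P.norm_sub_le_of_forall_abs_le fun k => abs_clip_sub_le ?_
  rw [← P.extend_coe z k]
  exact norm_le_pi_norm (P.extend z k.1.1) k.1.2

lemma eraseZeros_mem_ball {q z : P.Space} (hz : z ∈ P.Cbar q) : P.eraseZeros q z ∈ P.ball := by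
  obtain ⟨hsign, hlead, hγ⟩ := (P.mem_Cbar q z).1 hz
  refine P.mem_ball.2 ((Finset.sum_le_sum fun i _ => ?_).trans hγ)
  refine (pi_norm_le_iff_of_nonneg (sum_leadSign_mul_nonneg _ _ _ (hsign i))).2 fun j => ?_
  rw [P.extend_eraseZeros, Real.norm_eq_abs]
  split_ifs with h
  · rw [abs_zero]
    exact (hsign i j).trans (hlead i j)
  · exact (abs_eq_sign_mul h (hsign i j)).trans_le (hlead i j)

/-- The sign pattern and the leading entries of `q` are admissible for `q'` as well. -/
structure IsCompatible (q q' : P.Space) : Prop where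
  sign_mul : ∀ i j, Real.sign (P.extend q i j) * P.extend q' i j = |P.extend q' i j|
  abs_le_of_lead : ∀ i a, (∀ l, |P.extend q i l| ≤ |P.extend q i a|) →
    ∀ l, |P.extend q' i l| ≤ |P.extend q' i a|

lemma isCompatible_self (q : P.Space) : P.IsCompatible q q :=
  ⟨fun _ _ => sign_mul_self_eq_abs _, fun _ _ h => h⟩

lemma eventually_isCompatible (x : P.Space) : ∀ᶠ q in 𝓝 x, P.IsCompatible q x := by
  have hsign : ∀ᶠ q in 𝓝 x, ∀ i j,
      Real.sign (P.extend q i j) * P.extend x i j = |P.extend x i j| :=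
    eventually_all.2 fun i => eventually_all.2 fun j =>
      ((P.continuous_extend_apply i j).tendsto x).eventually (eventually_sign_mul_eq_abs _)
  have hlead : ∀ᶠ q in 𝓝 x, ∀ i a l, |P.extend q i l| ≤ |P.extend q i a| →
      |P.extend x i l| ≤ |P.extend x i a| :=
    eventually_all.2 fun i => eventually_all.2 fun a => eventually_all.2 fun l =>
      eventually_mem_imp_of_isClosed (F := {q | |P.extend q i l| ≤ |P.extend q i a|})
        (isClosed_le (P.continuous_extend_apply i l).abs (P.continuous_extend_apply i a).abs) x
  filter_upwards [hsign, hlead] with q hq hq'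
  exact ⟨hq, fun i a h l => hq' i a l (h l)⟩

lemma convex_Cbar (q : P.Space) : Convex ℝ (P.Cbar q) := convex_polyhedron

namespace IsCompatible

variable {P} {q q' : P.Space}

lemma clipRows_mem_Cbar (hq : P.IsCompatible q q') {θ : Fin d → ℝ} (hθ : 0 ≤ θ)
    (hγ : ∑ i, θ i ≤ P.γ) : P.clipRows θ q' ∈ P.Cbar q := by
  have sign_mul_extend (i j) : Real.sign (P.extend q i j) * P.extend (P.clipRows θ q') i j =
      min |P.extend q' i j| (θ i) := by
    rw [P.extend_clipRows hθ, sign_mul_clip (hq.sign_mul i j) (hθ i)]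
  refine (P.mem_Cbar q _).2 ⟨fun i j => ?_, fun i j => ?_, ?_⟩
  · rw [sign_mul_extend]
    exact le_min (abs_nonneg _) (hθ i)
  · obtain ⟨a, ha, hsum⟩ := leadSign_sum (P.extend q) i j
    rw [hsum (P.extend (P.clipRows θ q') i), sign_mul_extend, sign_mul_extend]
    exact min_le_min_right _ (hq.abs_le_of_lead i a ha j)
  · refine (Finset.sum_le_sum fun i _ => sum_leadSign_mul_le _ _ i (hθ i) fun l => ?_).trans hγ
    rw [sign_mul_extend]
    exact min_le_right _ _

lemma norm_eraseZeros_sub_le (hq : P.IsCompatible q q') (z : P.Space) :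
    ‖P.eraseZeros q z - q'‖ ≤ ‖z - q'‖ := by
  refine P.norm_sub_le_of_forall_abs_le fun k => ?_
  simp only [eraseZeros]
  split_ifs with h
  · have hk := hq.sign_mul k.1.1 k.1.2
    rw [extend_coe, extend_coe, h, Real.sign_zero, zero_mul, eq_comm, abs_eq_zero] at hk
    simp [hk]
  · exact le_rfl

theorem isProjection_Cbar (hq : P.IsCompatible q q') :
    IsProjection (P.Cbar q) q' (P.proj q') := by
  have hp := P.isProjection_proj q'
  refine ⟨?_, fun z hz =>
    (hp.2 _ (P.eraseZeros_mem_ball hz)).trans (hq.norm_eraseZeros_sub_le z)⟩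
  have hγ := P.mem_ball.1 hp.1
  have hθ : 0 ≤ fun i => ‖P.extend (P.proj q') i‖ := fun i => norm_nonneg _
  rw [← hp.eq_of_norm_sub_le P.convex_ball (P.clipRows_mem_ball hθ hγ q')
    (P.norm_clipRows_sub_le q' _)]
  exact hq.clipRows_mem_Cbar hθ hγ

lemma eq_proj (hq : P.IsCompatible q q') {p : P.Space} (hp : IsProjection (P.Cbar q) q' p) :
    p = P.proj q' :=
  hq.isProjection_Cbar.eq_of_norm_sub_le (P.convex_Cbar q) hp.1
    (hp.2 _ hq.isProjection_Cbar.1)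

end IsCompatible

lemma finite_range_Bbar : (Set.range P.Bbar).Finite := by
  refine (Set.Finite.pi fun _ : RowIdx d n => Set.Finite.pi fun _ : P.I =>
    finite_signValues.sub finite_signValues).subset ?_
  rintro _ ⟨q, rfl⟩ r - k -
  exact matB_mem_sub_signValues _ r k

theorem eventually_proj_sub (x : P.Space) :
    ∀ᶠ q in 𝓝 x, ∀ N ∈ hsJacobian (P.Bbar q) (vecC d n P.γ) q,
      P.proj q - P.proj x = Matrix.toEuclideanCLM (𝕜 := ℝ) N (q - x) ∧
      Matrix.toEuclideanCLM (𝕜 := ℝ) N (x - P.proj x) = 0 := by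
  filter_upwards [eventually_hsJacobian_linearizes P.finite_range_Bbar (vecC d n P.γ) x,
    P.eventually_isCompatible x] with q hq hqx N hN
  obtain ⟨p, p', hp, hp', hsub, hres⟩ := hq _ ⟨q, rfl⟩ N hN
  rw [(P.isCompatible_self q).eq_proj hp] at hsub
  rw [hqx.eq_proj hp'] at hsub hres
  exact ⟨hsub, hres⟩

end PALSubproblem

/-! ### The objective function of the subproblem -/

lemma toEuclideanCLM_transpose_mul_self {ι κ : Type*} [Fintype ι] [Fintype κ] [DecidableEq κ]
    (A : Matrix ι κ ℝ) :
    Matrix.toEuclideanCLM (𝕜 := ℝ) (Aᵀ * A) =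
      A.toEuclideanLin.toContinuousLinearMap.adjoint ∘L
        A.toEuclideanLin.toContinuousLinearMap := by
  classical
  ext1 v
  rw [← LinearMap.adjoint_toContinuousLinearMap, ← Matrix.toEuclideanLin_conjTranspose_eq_adjoint,
    Matrix.conjTranspose_eq_transpose_of_trivial]
  exact congrArg (WithLp.toLp 2) (Matrix.mulVec_mulVec v.ofLp Aᵀ A).symm

namespace PALSubproblem

variable {d n : ℕ} {m : Fin n → ℕ} (P : PALSubproblem d n m)

/-- The linear map `w ↦ X_I w`. -/
def design : P.Space →L[ℝ] EuclideanSpace ℝ ((i : Fin n) × Fin (m i)) :=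
  (Matrix.toEuclideanLin P.XI).toContinuousLinearMap

/-- The gradient of `φ`. -/
def grad (w : P.Space) : P.Space :=
  P.design.adjoint (P.design w - P.y) + P.σ • (P.shift w - P.proj (P.shift w)) +
    P.σ⁻¹ • (w - P.wt)

/-- The surrogate Hessian `X_Iᵀ X_I + σ (1 - N) + σ⁻¹` of `φ`, for an element `N` of the
HS-Jacobian. -/
def hessian (N : P.Space →L[ℝ] P.Space) : P.Space →L[ℝ] P.Space :=
  P.design.adjoint ∘L P.design + P.σ • (1 - N) + P.σ⁻¹ • 1

/-- An upper bound for the surrogate Hessians of `φ`. -/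
def curvature : ℝ := ‖P.design.adjoint ∘L P.design‖ + P.σ + P.σ⁻¹

lemma inv_σ_pos : 0 < P.σ⁻¹ := inv_pos.2 P.σ_pos

lemma inv_σ_le_curvature : P.σ⁻¹ ≤ P.curvature :=
  le_add_of_nonneg_left <| add_nonneg (norm_nonneg _) P.σ_pos.le

lemma φ_eq : P.φ = fun w => 1 / 2 * ‖P.y - P.design w‖ ^ 2 +
    P.σ * moreauIndicator P.ball (P.shift w) + P.σ⁻¹ * (1 / 2 * ‖w - P.wt‖ ^ 2) +
    -(1 / (2 * P.σ) * ‖P.ut‖ ^ 2) := by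
  funext w
  rw [φ, moreauIndicator_Cbar]
  change 1 / 2 * ‖P.y - P.design w‖ ^ 2 - _ + P.σ * moreauIndicator P.ball (P.shift w) + _ = _
  field_simp
  ring

lemma smul_one_le_hessian {N : P.Space →L[ℝ] P.Space} (hN : IsStarProjection N) :
    P.σ⁻¹ • 1 ≤ P.hessian N := by
  rw [ContinuousLinearMap.le_def, hessian, add_sub_cancel_right]
  exact (ContinuousLinearMap.isPositive_adjoint_comp_self _).add
    ((ContinuousLinearMap.IsPositive.of_isStarProjection hN.one_sub).smul_of_nonneg P.σ_pos.le)

lemma norm_hessian_le {N : P.Space →L[ℝ] P.Space} (hN : IsStarProjection N) :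
    ‖P.hessian N‖ ≤ P.curvature := by
  refine norm_add₃_le.trans (add_le_add_three le_rfl ?_ ?_)
  · rw [norm_smul, Real.norm_of_nonneg P.σ_pos.le]
    exact mul_le_of_le_one_right P.σ_pos.le (hN.one_sub.norm_le)
  · rw [norm_smul, Real.norm_of_nonneg P.inv_σ_pos.le]
    exact mul_le_of_le_one_right P.inv_σ_pos.le ContinuousLinearMap.norm_id_le

lemma hasExactExpansion_φ {N : P.Space →L[ℝ] P.Space} (hN : IsStarProjection N) {x w : P.Space}
    (hsub : P.proj (P.shift w) - P.proj (P.shift x) = N (P.shift w - P.shift x))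
    (hres : N (P.shift x - P.proj (P.shift x)) = 0) :
    HasExactExpansion P.φ P.grad (P.hessian N) x w := by
  rw [φ_eq]
  exact (((hasExactExpansion_leastSquares P.design P.y x w).add
    ((hasExactExpansion_moreauIndicator hN P.isProjection_proj hsub
      hres).comp_add_right.const_smul P.σ)).add
    ((hasExactExpansion_half_sq_norm_sub P.wt x w).const_smul P.σ⁻¹)).add_const _

lemma hasQuadraticBounds_φ : HasQuadraticBounds P.σ⁻¹ P.curvature P.φ P.grad := by
  have leastSquares : HasQuadraticBounds 0 ‖P.design.adjoint ∘L P.design‖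
      (fun w => 1 / 2 * ‖P.y - P.design w‖ ^ 2) (fun w => P.design.adjoint (P.design w - P.y)) :=
    .of_hasExactExpansion (hasExactExpansion_leastSquares P.design P.y)
      (by simpa only [zero_smul, ContinuousLinearMap.nonneg_iff_isPositive] using
        ContinuousLinearMap.isPositive_adjoint_comp_self P.design) le_rfl
  have envelope := hasQuadraticBounds_moreauIndicator P.convex_ball P.isProjection_proj
  have proximal : HasQuadraticBounds 1 1 (fun w => 1 / 2 * ‖w - P.wt‖ ^ 2) (fun w => w - P.wt) :=
    .of_hasExactExpansion (hasExactExpansion_half_sq_norm_sub P.wt) (one_smul ℝ _).le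
      ContinuousLinearMap.norm_id_le
  have H := ((leastSquares.add ((envelope.comp_add_right (P.σ⁻¹ • P.ut)).const_smul
    P.σ_pos.le)).add (proximal.const_smul P.inv_σ_pos.le)).add_const (-(1 / (2 * P.σ) * ‖P.ut‖ ^ 2))
  simp only [mul_zero, mul_one, zero_add] at H
  rw [φ_eq]
  exact H

/-- The surrogate Hessians `𝓜 w` as continuous linear maps. -/
def hessians (w : P.Space) : Set (P.Space →L[ℝ] P.Space) :=
  Matrix.toEuclideanCLM (𝕜 := ℝ) '' P.𝓜 w

lemma exists_of_mem_hessians {w : P.Space} {A : P.Space →L[ℝ] P.Space} (hA : A ∈ P.hessians w) :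
    ∃ N ∈ hsJacobian (P.Bbar (P.shift w)) (vecC d n P.γ) (P.shift w),
      A = P.hessian (Matrix.toEuclideanCLM (𝕜 := ℝ) N) := by
  obtain ⟨_, ⟨N, hN, rfl⟩, rfl⟩ := hA
  refine ⟨N, hN, ?_⟩
  rw [map_add, map_add, map_smul, map_smul, map_sub, map_one, toEuclideanCLM_transpose_mul_self,
    hessian, design]

lemma bounds_of_mem_hessians {w : P.Space} {A : P.Space →L[ℝ] P.Space} (hA : A ∈ P.hessians w) :
    P.σ⁻¹ • 1 ≤ A ∧ ‖A‖ ≤ P.curvature := by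
  obtain ⟨N, hN, rfl⟩ := P.exists_of_mem_hessians hA
  have hproj := isStarProjection_of_mem_hsJacobian hN
  exact ⟨P.smul_one_le_hessian hproj, P.norm_hessian_le hproj⟩

lemma eventually_hasExactExpansion_φ (x : P.Space) :
    ∀ᶠ w in 𝓝 x, ∀ A ∈ P.hessians w, HasExactExpansion P.φ P.grad A x w := by
  have hshift : Tendsto P.shift (𝓝 x) (𝓝 (P.shift x)) :=
    (continuous_id.add continuous_const).tendsto x
  filter_upwards [hshift.eventually (P.eventually_proj_sub (P.shift x))] with w hw A hA
  obtain ⟨N, hN, rfl⟩ := P.exists_of_mem_hessians hA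
  exact P.hasExactExpansion_φ (isStarProjection_of_mem_hsJacobian hN) (hw N hN).1 (hw N hN).2

end PALSubproblem

lemma IsSsnStep.isNewtonStep {d n : ℕ} {m : Fin n → ℕ} {P : PALSubproblem d n m} {ϱ ν τ ϖ : ℝ}
    {w w' : P.Space} (h : IsSsnStep P ϱ ν τ ϖ w w') :
    IsNewtonStep P.φ P.grad P.hessians ϱ ν τ ϖ w w' := by
  obtain ⟨M, hM, h, hcg, hres, hstep⟩ := h
  rw [P.hasQuadraticBounds_φ.gradient_eq] at hcg hres hstep
  exact ⟨_, ⟨M, hM, rfl⟩, h, hcg, hres, hstep⟩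

end MTLasso

end

open MTLasso Filter Topology Asymptotics in
theorem mainTheorem3_general {d n : ℕ} {m : Fin n → ℕ} (P : PALSubproblem d n m)
    (ϱ ν τ ϖ : ℝ) (hϱ : 0 < ϱ ∧ ϱ < 1 / 2) (hν : ν < 1) (hτ : 0 < τ) (hϖ : 0 < ϖ ∧ ϖ ≤ 1)
    (w : ℕ → P.Space) (hw : IsSsnSequence P ϱ ν τ ϖ w) :
    ContDiff ℝ 1 P.φ ∧ StrongConvexOn Set.univ P.σ⁻¹ P.φ ∧
    ∃ what : P.Space,
      (∀ v, P.φ what ≤ P.φ v) ∧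
      (∀ v, (∀ v', P.φ v ≤ P.φ v') → v = what) ∧
      Tendsto w atTop (𝓝 what) ∧
      (fun j => ‖w (j + 1) - what‖) =O[atTop] (fun j => ‖w j - what‖ ^ (1 + τ)) ∧
      (fun j => ‖w (j + 1) - what‖) =o[atTop] (fun j => ‖w j - what‖) ∧
      (τ = 1 → (fun j => ‖w (j + 1) - what‖) =O[atTop] (fun j => ‖w j - what‖ ^ 2)) := by
  have H := P.hasQuadraticBounds_φ
  have hσ := P.inv_σ_pos
  have hle := P.inv_σ_le_curvature
  exact ⟨H.contDiff_one hσ.le (hσ.trans_le hle), H.strongConvexOn,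
    H.newton_convergence hσ hle (fun _ _ => P.bounds_of_mem_hessians)
      P.eventually_hasExactExpansion_φ hϱ.1 hϱ.2 hν hτ hϖ.1 hϖ.2 fun j => (hw j).isNewtonStep⟩

open MTLasso Filter Topology Asymptotics in
theorem mainTheorem3 {d n : ℕ} {m : Fin n → ℕ} (P : PALSubproblem d n m)
    (ϱ ν τ ϖ : ℝ) (hϱ : 0 < ϱ ∧ ϱ < 1 / 2) (hν : 0 < ν ∧ ν < 1) (hτ : 0 < τ ∧ τ ≤ 1)
    (hϖ : 0 < ϖ ∧ ϖ < 1)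
    (w : ℕ → P.Space) (hw : IsSsnSequence P ϱ ν τ ϖ w) :
    ContDiff ℝ 1 P.φ ∧ StrongConvexOn Set.univ P.σ⁻¹ P.φ ∧
    ∃ what : P.Space,
      (∀ v, P.φ what ≤ P.φ v) ∧
      (∀ v, (∀ v', P.φ v ≤ P.φ v') → v = what) ∧
      Tendsto w atTop (𝓝 what) ∧
      (fun j => ‖w (j + 1) - what‖) =O[atTop] (fun j => ‖w j - what‖ ^ (1 + τ)) ∧
      (fun j => ‖w (j + 1) - what‖) =o[atTop] (fun j => ‖w j - what‖) ∧
      (τ = 1 → (fun j => ‖w (j + 1) - what‖) =O[atTop] (fun j => ‖w j - what‖ ^ 2)) :=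
  mainTheorem3_general P ϱ ν τ ϖ hϱ hν.2 hτ.1 ⟨hϖ.1, hϖ.2.le⟩ w hw
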